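/- Write $\langle j_1m_1,j_2m_2|jm\rangle$ for the SU(2) Clebsch–Gordan coefficients (Condon–Shortley convention). For an integer spin $S$, a finite set of virtual spins $\mathcal V$ and a real weight matrix $T=(T_{j_a,j_b})_{j_a,j_b\in\mathcal V}$ define the Kraus operators, acting on $\bigoplus_{j\in\mathcal V}\mathbb C^{2j+1}$, $$A^{[S,M]}_{j_am_a,j_bm_b}=T_{j_a,j_b}\,\langle j_am_a,SM|j_bm_b\rangle ,\qquad M=-S,\dots,S .$$ Let $F^{j_aSj_b}_{SS_Tj_c}=\langle j_b(j_aS),S;j_cm_c\,|\,j_a,S_T(SS);j_cm_c\rangle$ be the recoupling symbol and $R^{S_T}_{j_a,j_c}=\sum_{j_b}T_{j_a,j_b}F^{j_aSj_b}_{SS_Tj_c}T_{j_b,j_c}$. Consider the following ten models $(S,\mathcal K,\mathcal V,T)$. With a single virtual spin $j$ and $T=1$: $(S,\mathcal K,j)=(1,\{2\},\tfrac12)$, $(2,\{3,4\},1)$, $(2,\{2,4\},\tfrac32)$, $(3,\{4,5,6\},\tfrac32)$, $(4,\{5,6,7,8\},2)$, $(5,\{6,7,8,9,10\},\tfrac52)$,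 $(5,\{3,7,8,9,10\},3)$. With several virtual spins (rows and columns of $T$ in increasing order of $j$): * $S=3$, $\mathcal K=\{2,4,6\}$, $\mathcal V=0\oplus3$, $T=\begin{pmatrix}0&\frac{-1}{\sqrt7}\\1&\sqrt{\frac67}\end{pmatrix}$; * $S=4$, $\mathcal K=\{2,4,6,8\}$, $\mathcal V=2\oplus5$, $T=\begin{pmatrix}\frac13\sqrt{\frac72}&\frac13\sqrt{\frac52}\\ \frac{-1}3\sqrt{\frac{11}2}&\frac13\sqrt{\frac{13}2}\end{pmatrix}$; * $S=5$, $\mathcal K=\{2,4,6,8,10\}$, $\mathcal V=\frac52\oplus\frac92\oplus\frac{15}2$, $T=\begin{pmatrix}\frac1{11}\sqrt{\frac{21}2}&\frac{-3}{\sqrt{22}}&\frac{-1}{11}\sqrt{\frac{21}2}\\-\sqrt{\frac{15}{22}}&\sqrt{\frac3{26}}&-\sqrt{\frac{85}{286}}\\ \frac{2\sqrt7}{11}&2\sqrt{\frac{17}{143}}&\frac1{11}\sqrt{\frac{969}{13}}\end{pmatrix}$. Each of the ten models satisfies: 1. (fusion rule) $T_{j_a,j_b}=0$ unless $|j_a-S|\le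 j_b\le j_a+S$; 2. (isometry) $\sum_{j_a}T_{j_a,j_b}^2=1$ for every $j_b$, and $\sum_MA^{[S,M]\dagger}A^{[S,M]}=\mathbb 1$; 3. (renormalization condition) $R^{S_T}_{j_a,j_c}=0$ for all $j_a,j_c\in\mathcal V$ and all $S_T\in\mathcal K$; 4. for all couplings $J_{S_T}>0$ ($S_T\in\mathcal K$) and every $N\ge2$, the Hamiltonian $H=\sum_{i=1}^{N}\sum_{S_T\in\mathcal K}J_{S_T}P_{S_T}(i,i+1)$ of the periodic spin-$S$ chain with $N$ sites, where $P_{S_T}(i,i+1)$ is the orthogonal projector onto the states in which the sites $i,i+1$ have total spin $S_T$, is positive semidefinite, and the translationally invariant matrix product state $$|\Psi\rangle=\sum_{M_1,\dots,M_N}\mathrm{Tr}\big(A^{[S,M_1]}\cdots A^{[S,M_N]}\big)|M_1,\dots,M_N\rangle$$ satisfies $H|\Psi\rangle=0$. Moreover $|\Psi\rangle\ne0$ whenever $N$ is even or $N\ge2S+1$, so that $|\Psi\rangle$ is then a zero-energy ground state of $H$. -/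

import Mathlib

/-!
Conventions. A spin `j ∈ {0, 1/2, 1, …}` is encoded by the natural number `J = 2 * j`. The standard
basis vector `|j m⟩`, `m = -j, …, j`, is encoded by `k : Fin (J + 1)` with `m = k - J / 2`, so that
`j + m = k` and `j - m = J - k`. Physical spins are integers `S : ℕ`, encoded by `2 * S`.
-/

namespace SpinChain

noncomputable section

open scoped Matrix BigOperators

/-- The Clebsch-Gordan coefficient `⟨j₁ m₁, j₂ m₂ | j m⟩` in the Condon-Shortley convention, given by
Racah's formula. Here `a = j₁ + j₂ - j`, `b = j₁ + j - j₂`, `c = j₂ + j - j₁`; the coefficient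
vanishes unless `m = m₁ + m₂`, `|j₁ - j₂| ≤ j ≤ j₁ + j₂` and `j₁ + j₂ + j` is an integer. The sum is
over those `n` for which the arguments of all factorials are nonnegative. -/
def cg (J₁ J₂ J : ℕ) (k₁ : Fin (J₁ + 1)) (k₂ : Fin (J₂ + 1)) (k : Fin (J + 1)) : ℝ :=
  if (2 * (k₁ : ℤ) - J₁) + (2 * (k₂ : ℤ) - J₂) = 2 * (k : ℤ) - J ∧
      J ≤ J₁ + J₂ ∧ J₁ ≤ J₂ + J ∧ J₂ ≤ J₁ + J ∧ Even (J₁ + J₂ + J) then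
    let a : ℕ := (J₁ + J₂ - J) / 2
    let b : ℕ := (J₁ + J - J₂) / 2
    let c : ℕ := (J₂ + J - J₁) / 2
    Real.sqrt (((J : ℝ) + 1) * a.factorial * b.factorial * c.factorial /
        ((J₁ + J₂ + J) / 2 + 1).factorial) *
      Real.sqrt (((k : ℕ).factorial : ℝ) * (J - k : ℕ).factorial *
        (k₁ : ℕ).factorial * (J₁ - k₁ : ℕ).factorial *
        (k₂ : ℕ).factorial * (J₂ - k₂ : ℕ).factorial) *
      ∑ n ∈ (Finset.range (a + 1)).filter (fun n : ℕ =>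
          n ≤ J₁ - k₁ ∧ n ≤ (k₂ : ℕ) ∧ a ≤ k₁ + n ∧ a ≤ (J₂ - k₂) + n),
        (-1 : ℝ) ^ n /
          ((n.factorial : ℝ) * (a - n).factorial * (J₁ - k₁ - n : ℕ).factorial *
            (k₂ - n : ℕ).factorial * (k₁ + n - a : ℕ).factorial *
            ((J₂ - k₂) + n - a : ℕ).factorial)
  else 0

/-- The components of `|j_b (j_a s), s; j_c m_c⟩` in the basis `|j_a m_a⟩ |s M₁⟩ |s M₂⟩`: first
`j_a ⊗ s → j_b`, then `j_b ⊗ s → j_c`. -/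
def coupledLeft (Ja s Jb Jc : ℕ) (kc : Fin (Jc + 1))
    (x : Fin (Ja + 1) × Fin (s + 1) × Fin (s + 1)) : ℝ :=
  ∑ kb : Fin (Jb + 1), cg Ja s Jb x.1 x.2.1 kb * cg Jb s Jc kb x.2.2 kc

/-- The components of `|j_a, s_T (s s); j_c m_c⟩` in the basis `|j_a m_a⟩ |s M₁⟩ |s M₂⟩`: first
`s ⊗ s → s_T`, then `j_a ⊗ s_T → j_c`. -/
def coupledRight (Ja s sT Jc : ℕ) (kc : Fin (Jc + 1))
    (x : Fin (Ja + 1) × Fin (s + 1) × Fin (s + 1)) : ℝ :=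
  ∑ kT : Fin (sT + 1), cg s s sT x.2.1 x.2.2 kT * cg Ja sT Jc x.1 kT kc

/-- The recoupling `F`-symbol `⟨j_b (j_a s), s; j_c m_c | j_a, s_T (s s); j_c m_c⟩`. (Its value does
not depend on `m_c`; the argument `kc` is kept.) -/
def fSymbol (Ja s Jb sT Jc : ℕ) (kc : Fin (Jc + 1)) : ℝ :=
  ∑ x : Fin (Ja + 1) × Fin (s + 1) × Fin (s + 1),
    coupledLeft Ja s Jb Jc kc x * coupledRight Ja s sT Jc kc x

/-- The data of a model: physical spin `S`, the set `K` of penalized total spins, the virtual spins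
`j_a = virt a / 2`, `a : Fin n`, and the weight matrix `T`. -/
structure Model where
  S : ℕ
  K : Finset ℕ
  n : ℕ
  virt : Fin n → ℕ
  T : Matrix (Fin n) (Fin n) ℝ

namespace Model

/-- A model with a single virtual spin `J / 2` and weight matrix `T = 1`. -/
def irreducible (S : ℕ) (K : Finset ℕ) (J : ℕ) : Model where
  S := S
  K := K
  n := 1
  virt := ![J]
  T := !![1]

/-- `S = 3`, `K = {2,4,6}`, virtual spins `0 ⊕ 3`. -/
def so7 : Model where
  S := 3
  K := {2, 4, 6}
  n := 2
  virt := ![0, 6]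
  T := !![0, -1 / √7;
          1, √(6 / 7)]

/-- `S = 4`, `K = {2,4,6,8}`, virtual spins `2 ⊕ 5`. -/
def so9 : Model where
  S := 4
  K := {2, 4, 6, 8}
  n := 2
  virt := ![4, 10]
  T := !![1 / 3 * √(7 / 2), 1 / 3 * √(5 / 2);
          -1 / 3 * √(11 / 2), 1 / 3 * √(13 / 2)]

/-- `S = 5`, `K = {2,4,6,8,10}`, virtual spins `5/2 ⊕ 9/2 ⊕ 15/2`. -/
def so11 : Model where
  S := 5
  K := {2, 4, 6, 8, 10}
  n := 3
  virt := ![5, 9, 15]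
  T := !![1 / 11 * √(21 / 2), -3 / √22, -1 / 11 * √(21 / 2);
          -√(15 / 22), √(3 / 26), -√(85 / 286);
          2 * √7 / 11, 2 * √(17 / 143), 1 / 11 * √(969 / 13)]

/-- The ten models with their virtual spins and weight matrices. -/
def table : List Model :=
  [irreducible 1 {2} 1,
   irreducible 2 {3, 4} 2,
   irreducible 2 {2, 4} 3,
   irreducible 3 {4, 5, 6} 3,
   so7,
   irreducible 4 {5, 6, 7, 8} 4,
   so9,
   irreducible 5 {6, 7, 8, 9, 10} 5,
   so11,
   irreducible 5 {3, 7, 8, 9, 10} 6]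

variable (m : Model)

/-- The basis of the virtual space `⊕_a j_a`. -/
abbrev VirtIndex : Type := Σ a : Fin m.n, Fin (m.virt a + 1)

/-- The Kraus operators `A^{[S,M]}_{j_a m_a, j_b m_b} = T_{j_a, j_b} ⟨j_a m_a, S M | j_b m_b⟩`. -/
def kraus (M : Fin (2 * m.S + 1)) : Matrix m.VirtIndex m.VirtIndex ℂ :=
  Matrix.of fun x y =>
    ((m.T x.1 y.1 * cg (m.virt x.1) (2 * m.S) (m.virt y.1) x.2 M y.2 : ℝ) : ℂ)

/-- Fusion rule: `T_{j_a, j_b} = 0` unless `|j_a - S| ≤ j_b ≤ j_a + S`. -/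
def FusionRule : Prop :=
  ∀ a b, ¬ (|(m.virt a : ℤ) - 2 * m.S| ≤ m.virt b ∧ m.virt b ≤ m.virt a + 2 * m.S) → m.T a b = 0

/-- The columns of `T` that belong to the same virtual spin `j_b` are orthonormal. -/
def WeightIsometry : Prop :=
  ∀ b b', m.virt b = m.virt b' → ∑ a, m.T a b * m.T a b' = if b = b' then 1 else 0

/-- `∑_M A^{[M]†} A^{[M]} = 1`. -/
def KrausIsometry : Prop :=
  ∑ M, (m.kraus M)ᴴ * m.kraus M = 1

/-- The two-site weight
`R^{S_T}_{j_a, j_c} = ∑_{j_b} T_{j_a, j_b} F^{j_a S j_b}_{S S_T j_c} T_{j_b, j_c}`. -/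
def R (ST : ℕ) (a c : Fin m.n) (kc : Fin (m.virt c + 1)) : ℝ :=
  ∑ b, m.T a b * fSymbol (m.virt a) (2 * m.S) (m.virt b) (2 * ST) (m.virt c) kc * m.T b c

/-- The renormalization condition `R^{S_T}_{j_a, j_c} = 0` for all `j_a`, `j_c` and `S_T ∈ K`. -/
def RenormalizationCondition : Prop :=
  ∀ ST ∈ m.K, ∀ a c kc, m.R ST a c kc = 0

end Model

/-- The spin operator `S^z` of spin `J / 2`. -/
def spinZ (J : ℕ) : Matrix (Fin (J + 1)) (Fin (J + 1)) ℂ :=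
  Matrix.diagonal fun k => (k : ℂ) - (J : ℂ) / 2

/-- The raising operator `S^+ |j m⟩ = √((j - m) (j + m + 1)) |j m+1⟩` of spin `J / 2`. -/
def spinPlus (J : ℕ) : Matrix (Fin (J + 1)) (Fin (J + 1)) ℂ :=
  Matrix.of fun k l =>
    if (k : ℕ) = l + 1 then ((√(((J : ℝ) - l) * (l + 1)) : ℝ) : ℂ) else 0

/-- The three spin operators `S^x`, `S^y`, `S^z` of spin `J / 2`. -/
def spin (J : ℕ) : Fin 3 → Matrix (Fin (J + 1)) (Fin (J + 1)) ℂ :=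
  ![(1 / 2 : ℂ) • (spinPlus J + (spinPlus J)ᴴ),
    (1 / (2 * Complex.I) : ℂ) • (spinPlus J - (spinPlus J)ᴴ),
    spinZ J]

/-- The Hilbert space `(ℂ^d)^{⊗ N}`, with orthonormal basis `|M_1, …, M_N⟩`. -/
abbrev Chain (N d : ℕ) : Type := EuclideanSpace ℂ (Fin N → Fin d)

/-- The operator on the chain that acts as `X` on site `i` and as the identity on all others. -/
def siteOp {N d : ℕ} (i : Fin N) (X : Matrix (Fin d) (Fin d) ℂ) :
    Matrix (Fin N → Fin d) (Fin N → Fin d) ℂ :=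
  Matrix.of fun σ τ => if ∀ k, k ≠ i → σ k = τ k then X (σ i) (τ i) else 0

/-- The squared total spin `(S_i + S_j)²` of the sites `i` and `j`, in a chain of spins `S`. -/
def totalSpinSq {N : ℕ} (S : ℕ) (i j : Fin N) :
    Matrix (Fin N → Fin (2 * S + 1)) (Fin N → Fin (2 * S + 1)) ℂ :=
  ∑ a : Fin 3, (siteOp i (spin (2 * S) a) + siteOp j (spin (2 * S) a)) ^ 2

/-- `P_{S_T}(i, j)`: the orthogonal projection onto the states in which the sites `i` and `j` have
total spin `S_T`, i.e. onto the eigenspace of `(S_i + S_j)²` for the eigenvalue `S_T (S_T + 1)`. -/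
def proj {N : ℕ} (S ST : ℕ) (i j : Fin N) :
    Chain N (2 * S + 1) →L[ℂ] Chain N (2 * S + 1) :=
  (Module.End.eigenspace (Matrix.toEuclideanLin (totalSpinSq S i j))
    ((ST : ℂ) * (ST + 1))).starProjection

namespace Model

variable (m : Model)

/-- The Hamiltonian `H = ∑_i ∑_{S_T ∈ K} J_{S_T} P_{S_T}(i, i+1)` of the periodic chain of `N`
sites (`finRotate N` is the cyclic shift `i ↦ i + 1`). -/
def hamiltonian (J : ℕ → ℝ) (N : ℕ) : Chain N (2 * m.S + 1) →L[ℂ] Chain N (2 * m.S + 1) :=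
  ∑ i : Fin N, ∑ ST ∈ m.K, (J ST : ℂ) • proj m.S ST i (finRotate N i)

/-- The translationally invariant matrix product state
`|Ψ⟩ = ∑ Tr (A^{[M_1]} ⋯ A^{[M_N]}) |M_1, …, M_N⟩`. -/
def mps (N : ℕ) : Chain N (2 * m.S + 1) :=
  WithLp.toLp 2 fun σ => Matrix.trace (List.ofFn fun i => m.kraus (σ i)).prod

end Model

end

end SpinChain

/-! ### Racah sums and the ladder recursions of the Clebsch–Gordan coefficients. -/

namespace SpinChain

open scoped Matrix

noncomputable section

/-! The Clebsch–Gordan coefficients intertwine the ladder operators, so the Kraus operators form a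
tensor operator of spin S on the virtual space (`isTensorOp_realKraus`), and so do the combinations
`couple` of two of them to a total spin S_T. Both the renormalization condition and the zero-energy
property follow once these combinations vanish for S_T in K.

Indeed R is a contraction of the coupled operators (`R_eq_sum_couple`). By completeness
(`sum_cg_mul_cg`) a product of two neighbouring Kraus operators is the sum of its coupled parts, so
the matrix product state is a sum of states in which the two sites have a definite total spin. Those
of spin different from S_T are orthogonal to the range of the projector, and the part of spin S_T is
zero (`proj_mps`). The isometry property is the orthonormality of the coefficients, proved as in
Schur's lemma: their Gram matrix intertwines the ladder operators, and the norm is computed at the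
highest weight.

For the nonvanishing, the singlet part is t times the identity with t ≠ 0. If the state on N sites
were zero, replacing n pairs of neighbours by singlets would give t^n tr(W) = 0 for every word W of
length N - 2n. The empty word excludes this for even N, and one word of length 2S + 1 with nonzero
trace excludes it for odd N ≥ 2S + 1 (`mps_ne_zero`).

What depends on the model is finite: a tensor operator is zero if it is zero between lowest states,
and a diagonal rescaling of the basis (`IsGauge`) turns these matrix elements and the trace into
nonzero multiples of integers, which are then evaluated. -/

/-- `1 / z!`, extended by zero to negative integers. -/
def invFact (z : ℤ) : ℝ := if 0 ≤ z then ((z.toNat.factorial : ℕ) : ℝ)⁻¹ else 0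

theorem invFact_natCast (n : ℕ) : invFact n = ((n.factorial : ℕ) : ℝ)⁻¹ := by
  simp [invFact]

theorem invFact_of_neg {z : ℤ} (h : z < 0) : invFact z = 0 := by
  simp [invFact, not_le.mpr h]

/-- Valid for every integer, since at z ≤ 0 both sides vanish; this is why the extension by zero
lets the recursions below avoid boundary cases. -/
theorem mul_invFact (z : ℤ) : (z : ℝ) * invFact z = invFact (z - 1) := by
  rcases lt_trichotomy z 0 with h | rfl | h
  · rw [invFact_of_neg h, invFact_of_neg (by omega), mul_zero]
  · rw [invFact_of_neg (z := 0 - 1) (by omega)]; simp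
  · obtain ⟨n, rfl⟩ : ∃ n : ℕ, z = n + 1 := ⟨(z - 1).toNat, by omega⟩
    have : ((n : ℤ) + 1 - 1) = (n : ℤ) := by ring
    rw [this, invFact_natCast, show ((n : ℤ) + 1) = ((n + 1 : ℕ) : ℤ) by push_cast; rfl,
      invFact_natCast, Nat.factorial_succ]
    push_cast
    have : (n.factorial : ℝ) ≠ 0 := by positivity
    have : (n : ℝ) + 1 ≠ 0 := by positivity
    field_simp

/-- The summand of Racah's formula without its sign. -/
def racahTerm (a α β γ δ n : ℤ) : ℝ :=
  invFact n * invFact (a - n) * invFact (α - n) * invFact (β - n) * invFact (γ + n) *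
    invFact (δ + n)

/-- The alternating sum of Racah's formula. -/
def racahSum (a : ℕ) (α β γ δ : ℤ) : ℝ :=
  ∑ n ∈ Finset.range (a + 1), (-1 : ℝ) ^ n * racahTerm a α β γ δ n

theorem racahTerm_eq_zero {a α β γ δ n : ℤ}
    (h : α < n ∨ β < n ∨ γ + n < 0 ∨ δ + n < 0) : racahTerm a α β γ δ n = 0 := by
  unfold racahTerm
  rcases h with h | h | h | h
  · rw [invFact_of_neg (z := α - n) (by omega)]; ring
  · rw [invFact_of_neg (z := β - n) (by omega)]; ring
  · rw [invFact_of_neg (z := γ + n) (by omega)]; ring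
  · rw [invFact_of_neg (z := δ + n) (by omega)]; ring

/-- Each alternative makes one of the upper bounds a, α, β on n smaller than one of the lower bounds
0, -γ, -δ. -/
theorem racahSum_eq_zero {a : ℕ} {α β γ δ : ℤ}
    (h : α < 0 ∨ β < 0 ∨ γ + a < 0 ∨ δ + a < 0 ∨ β + γ < 0 ∨ α + δ < 0) :
    racahSum a α β γ δ = 0 := by
  refine Finset.sum_eq_zero fun n hn => ?_
  have hn' : (n : ℤ) ≤ a := by have := Finset.mem_range.mp hn; omega
  rw [racahTerm_eq_zero (by omega), mul_zero]

theorem sum_alternating_shift (a : ℕ) (u : ℤ → ℝ) (h₁ : u (-1) = 0) (h₂ : u a = 0) :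
    ∑ n ∈ Finset.range (a + 1), (-1 : ℝ) ^ n * u n +
      ∑ n ∈ Finset.range (a + 1), (-1 : ℝ) ^ n * u (n - 1) = 0 := by
  rw [Finset.sum_range_succ, Finset.sum_range_succ' (fun n => (-1 : ℝ) ^ n * u ((n : ℤ) - 1))]
  simp only [Nat.cast_zero, zero_sub, h₁, h₂, mul_zero, add_zero, ← Finset.sum_add_distrib]
  refine Finset.sum_eq_zero fun n _ => ?_
  push_cast
  rw [add_sub_cancel_right]
  ring

/-- Termwise, split γ + a + 1 = (γ + 1 + n) + (a - n) and β + 1 = (β + 1 - n) + n. The first pieces,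
after the factorials absorb them, carry the factors α - n and δ + n, whose sum is α + δ; the second
pieces are u n and u (n - 1), which cancel in the alternating sum. -/
theorem racahSum_lower (a : ℕ) (α β γ δ : ℤ) :
    ((γ + a + 1 : ℤ) : ℝ) * racahSum a (α - 1) β (γ + 1) δ +
      ((β + 1 : ℤ) : ℝ) * racahSum a α (β + 1) γ (δ - 1) =
      ((α + δ : ℤ) : ℝ) * racahSum a α β γ δ := by
  set u : ℤ → ℝ := fun n => invFact n * invFact (a - 1 - n) * invFact (α - 1 - n) *
    invFact (β - n) * invFact (γ + 1 + n) * invFact (δ + n) with hu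
  have key := sum_alternating_shift a u
    (by simp only [hu]; rw [invFact_of_neg (z := -1) (by omega)]; ring)
    (by simp only [hu]; rw [invFact_of_neg (z := (a : ℤ) - 1 - a) (by omega)]; ring)
  have e1 : ∀ n : ℤ, ((γ + a + 1 : ℤ) : ℝ) * racahTerm a (α - 1) β (γ + 1) δ n =
      ((α - n : ℤ) : ℝ) * racahTerm a α β γ δ n + u n := by
    intro n
    have h1 := mul_invFact (γ + 1 + n)
    have h2 := mul_invFact (a - n)
    have h3 := mul_invFact (α - n)
    rw [show γ + 1 + n - 1 = γ + n by ring] at h1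
    rw [show (a : ℤ) - n - 1 = a - 1 - n by ring] at h2
    rw [show α - n - 1 = α - 1 - n by ring] at h3
    simp only [hu, racahTerm]
    rw [← h2, ← h3, ← h1]
    push_cast
    ring
  have e2 : ∀ n : ℤ, ((β + 1 : ℤ) : ℝ) * racahTerm a α (β + 1) γ (δ - 1) n =
      ((δ + n : ℤ) : ℝ) * racahTerm a α β γ δ n + u (n - 1) := by
    intro n
    have h1 := mul_invFact (β + 1 - n)
    have h2 := mul_invFact n
    have h3 := mul_invFact (δ + n)
    rw [show β + 1 - n - 1 = β - n by ring] at h1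
    rw [show δ + n - 1 = δ - 1 + n by ring] at h3
    simp only [hu, racahTerm]
    rw [show (a : ℤ) - 1 - (n - 1) = a - n by ring, show α - 1 - (n - 1) = α - n by ring,
      show β - (n - 1) = β + 1 - n by ring, show γ + 1 + (n - 1) = γ + n by ring,
      show δ + (n - 1) = δ - 1 + n by ring, ← h2, ← h1, ← h3]
    push_cast
    ring
  unfold racahSum
  simp only [Finset.mul_sum]
  rw [← Finset.sum_add_distrib, ← sub_eq_zero, ← Finset.sum_sub_distrib]
  rw [← Finset.sum_add_distrib] at key
  rw [← key]
  refine Finset.sum_congr rfl fun n _ => ?_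
  have := e1 n
  have := e2 n
  push_cast at *
  linear_combination (-1 : ℝ) ^ n * e1 n + (-1 : ℝ) ^ n * e2 n

/-- The substitution n ↦ a - n. In terms of spins it reverses all magnetic quantum numbers. -/
theorem racahSum_reflect (a : ℕ) (α β γ δ : ℤ) :
    racahSum a (γ + a) (δ + a) (α - a) (β - a) = (-1 : ℝ) ^ a * racahSum a α β γ δ := by
  unfold racahSum
  rw [← Finset.sum_range_reflect, Finset.mul_sum]
  refine Finset.sum_congr rfl fun n hn => ?_
  have hn' : n ≤ a := by have := Finset.mem_range.mp hn; omega
  have h : (-1 : ℝ) ^ (a + 1 - 1 - n) = (-1) ^ a * (-1) ^ n := by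
    obtain ⟨c, rfl⟩ := Nat.exists_eq_add_of_le hn'
    rw [show n + c + 1 - 1 - n = c by omega, pow_add]
    have : ((-1 : ℝ) ^ n) * (-1) ^ n = 1 := by rw [← mul_pow]; simp
    linear_combination -(-1 : ℝ) ^ c * this
  rw [h, show ((a + 1 - 1 - n : ℕ) : ℤ) = (a : ℤ) - n by omega]
  simp only [racahTerm]
  rw [show (a : ℤ) - (a - n) = n by ring, show γ + a - (a - n) = γ + n by ring,
    show δ + a - (a - n) = δ + n by ring, show α - a + (a - (n : ℤ)) = α - n by ring,
    show β - a + (a - (n : ℤ)) = β - n by ring]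
  ring

/-- This is `racahSum_lower` for the reversed magnetic numbers; the sign (-1)^a is common to the
three sums. -/
theorem racahSum_raise (a : ℕ) (α β γ δ : ℤ) :
    ((α + 1 : ℤ) : ℝ) * racahSum a (α + 1) β (γ - 1) δ +
      ((δ + a + 1 : ℤ) : ℝ) * racahSum a α (β - 1) γ (δ + 1) =
      ((β + γ : ℤ) : ℝ) * racahSum a α β γ δ := by
  have h := racahSum_lower a (γ + a) (δ + a) (α - a) (β - a)
  have h1 := racahSum_reflect a (α + 1) β (γ - 1) δ
  have h2 := racahSum_reflect a α (β - 1) γ (δ + 1)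
  have h3 := racahSum_reflect a α β γ δ
  rw [show γ - 1 + (a : ℤ) = γ + a - 1 by ring, show α + 1 - (a : ℤ) = α - a + 1 by ring] at h1
  rw [show δ + 1 + (a : ℤ) = δ + a + 1 by ring, show β - 1 - (a : ℤ) = β - a - 1 by ring] at h2
  rw [h1, h2, h3] at h
  have : ((-1 : ℝ) ^ a) * (-1) ^ a = 1 := by rw [← mul_pow]; simp
  have h' : (-1 : ℝ) ^ a * (((α + 1 : ℤ) : ℝ) * racahSum a (α + 1) β (γ - 1) δ +
      ((δ + a + 1 : ℤ) : ℝ) * racahSum a α (β - 1) γ (δ + 1)) =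
      (-1 : ℝ) ^ a * (((β + γ : ℤ) : ℝ) * racahSum a α β γ δ) := by
    push_cast at *
    linear_combination h
  exact mul_left_cancel₀ (by intro h0; rw [h0] at this; simp at this) h'

/-- The selection rules on three spins. -/
def Triangle (J₁ J₂ J : ℕ) : Prop :=
  J ≤ J₁ + J₂ ∧ J₁ ≤ J₂ + J ∧ J₂ ≤ J₁ + J ∧ Even (J₁ + J₂ + J)

instance (J₁ J₂ J : ℕ) : Decidable (Triangle J₁ J₂ J) :=
  inferInstanceAs (Decidable (_ ∧ _ ∧ _ ∧ _))

/-- `√((j + m)! (j - m)!)`. -/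
def rootFact (J : ℕ) (k : ℤ) : ℝ := √((k.toNat.factorial : ℝ) * (J - k).toNat.factorial)

/-- The normalization `√((2j + 1) a! b! c! / (a + b + c + 1)!)` of Racah's formula. -/
def racahNorm (J₁ J₂ J : ℕ) : ℝ :=
  √(((J : ℝ) + 1) * ((J₁ + J₂ - J) / 2).factorial * ((J₁ + J - J₂) / 2).factorial *
    ((J₂ + J - J₁) / 2).factorial / ((J₁ + J₂ + J) / 2 + 1).factorial)

/-- Clebsch-Gordan coefficients with arbitrary integers in place of the magnetic indices. -/
def cgInt (J₁ J₂ J : ℕ) (k₁ k₂ k : ℤ) : ℝ :=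
  if Triangle J₁ J₂ J ∧ k₁ + k₂ = k + ((J₁ + J₂ - J) / 2 : ℕ) then
    racahNorm J₁ J₂ J * (rootFact J₁ k₁ * rootFact J₂ k₂ * rootFact J k) *
      racahSum ((J₁ + J₂ - J) / 2) (J₁ - k₁) k₂ (k₁ - ((J₁ + J₂ - J) / 2 : ℕ))
        (J₂ - k₂ - ((J₁ + J₂ - J) / 2 : ℕ))
  else 0

/-- The filter on n is what the zeros of `invFact` impose by themselves. With integer indices the
neighbours k ± 1 need no proof of being in range. -/
theorem cg_eq_cgInt (J₁ J₂ J : ℕ) (k₁ : Fin (J₁ + 1)) (k₂ : Fin (J₂ + 1)) (k : Fin (J + 1)) :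
    cg J₁ J₂ J k₁ k₂ k = cgInt J₁ J₂ J (k₁ : ℕ) (k₂ : ℕ) (k : ℕ) := by
  unfold cg cgInt
  have hiff : ((2 * (k₁ : ℤ) - J₁) + (2 * (k₂ : ℤ) - J₂) = 2 * (k : ℤ) - J ∧
      J ≤ J₁ + J₂ ∧ J₁ ≤ J₂ + J ∧ J₂ ≤ J₁ + J ∧ Even (J₁ + J₂ + J)) ↔
      (Triangle J₁ J₂ J ∧ ((k₁ : ℕ) : ℤ) + (k₂ : ℕ) = (k : ℕ) + ((J₁ + J₂ - J) / 2 : ℕ)) := by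
    unfold Triangle
    constructor
    · rintro ⟨h1, h2, h3, h4, h5⟩
      refine ⟨⟨h2, h3, h4, h5⟩, ?_⟩
      obtain ⟨r, hr⟩ := h5
      omega
    · rintro ⟨⟨h2, h3, h4, h5⟩, h1⟩
      refine ⟨?_, h2, h3, h4, h5⟩
      obtain ⟨r, hr⟩ := h5
      omega
  by_cases h : Triangle J₁ J₂ J ∧
      ((k₁ : ℕ) : ℤ) + (k₂ : ℕ) = (k : ℕ) + ((J₁ + J₂ - J) / 2 : ℕ)
  · rw [if_pos (hiff.mpr h), if_pos h]
    have b1 := k₁.is_le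
    have b2 := k₂.is_le
    have b3 := k.is_le
    simp only
    congr 1
    · unfold racahNorm rootFact
      congr 1
      rw [← Real.sqrt_mul (by positivity), ← Real.sqrt_mul (by positivity)]
      congr 1
      rw [show ((J₁ : ℤ) - (k₁ : ℕ)).toNat = J₁ - k₁ by omega,
        show ((J₂ : ℤ) - (k₂ : ℕ)).toNat = J₂ - k₂ by omega,
        show ((J : ℤ) - (k : ℕ)).toNat = J - k by omega]
      simp only [Int.toNat_natCast]
      ring
    · unfold racahSum
      set a := (J₁ + J₂ - J) / 2
      rw [Finset.sum_filter]
      refine Finset.sum_congr rfl fun n hn => ?_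
      have hn' : n ≤ a := by have := Finset.mem_range.mp hn; omega
      split_ifs with hc
      · obtain ⟨c1, c2, c3, c4⟩ := hc
        unfold racahTerm
        rw [show (a : ℤ) - n = ((a - n : ℕ) : ℤ) by omega,
          show (J₁ : ℤ) - (k₁ : ℕ) - n = ((J₁ - k₁ - n : ℕ) : ℤ) by omega,
          show ((k₂ : ℕ) : ℤ) - n = ((k₂ - n : ℕ) : ℤ) by omega,
          show ((k₁ : ℕ) : ℤ) - a + n = ((k₁ + n - a : ℕ) : ℤ) by omega,
          show (J₂ : ℤ) - (k₂ : ℕ) - a + n = ((J₂ - k₂ + n - a : ℕ) : ℤ) by omega]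
        simp only [invFact_natCast]
        rw [div_eq_mul_inv]
        congr 1
        simp only [mul_inv]
      · rw [racahTerm_eq_zero, mul_zero]
        omega
  · rw [if_neg (fun h' => h (hiff.mp h')), if_neg h]

/-- The matrix element `√((j + m) (j - m + 1))` of the lowering operator. -/
def ladder (J : ℕ) (k : ℤ) : ℝ := √(((J - k + 1 : ℤ) : ℝ) * k)

theorem ladder_zero (J : ℕ) : ladder J 0 = 0 := by simp [ladder]

theorem ladder_top (J : ℕ) : ladder J (J + 1) = 0 := by simp [ladder]

theorem ladder_pos {J : ℕ} {k : ℤ} (h₀ : 0 < k) (h : k ≤ J) : 0 < ladder J k := by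
  unfold ladder
  apply Real.sqrt_pos.mpr
  have h1 : (0 : ℝ) < (k : ℝ) := by exact_mod_cast h₀
  have h2 : (0 : ℝ) < ((J - k + 1 : ℤ) : ℝ) := by exact_mod_cast (by omega : (0 : ℤ) < J - k + 1)
  positivity

theorem ladder_mul_self {J : ℕ} {k : ℤ} (h₀ : 0 ≤ k) (h : k ≤ J + 1) :
    ladder J k * ladder J k = ((J - k + 1 : ℤ) : ℝ) * k := by
  unfold ladder
  apply Real.mul_self_sqrt
  have h1 : (0 : ℝ) ≤ (k : ℝ) := by exact_mod_cast h₀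
  have h2 : (0 : ℝ) ≤ ((J - k + 1 : ℤ) : ℝ) := by exact_mod_cast (by omega : (0 : ℤ) ≤ J - k + 1)
  positivity

theorem ladder_mul_rootFact {J : ℕ} {k : ℤ} (h₀ : 0 < k) (h : k ≤ J) :
    ladder J k * rootFact J k = (k : ℝ) * rootFact J (k - 1) ∧
      ladder J k * rootFact J (k - 1) = ((J - k + 1 : ℤ) : ℝ) * rootFact J k := by
  obtain ⟨p, rfl⟩ : ∃ p : ℕ, k = p + 1 := ⟨(k - 1).toNat, by omega⟩
  obtain ⟨q, hq⟩ : ∃ q : ℕ, (J : ℤ) = p + 1 + q := ⟨(J - p - 1 : ℤ).toNat, by omega⟩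
  unfold ladder rootFact
  rw [hq, show ((p : ℤ) + 1).toNat = p + 1 by omega, show (p : ℤ) + 1 - 1 = p by ring,
    show ((p : ℤ) + 1 + q - (p + 1)).toNat = q by omega,
    show ((p : ℤ) + 1 + q - p).toNat = q + 1 by omega, Int.toNat_natCast,
    show ((p : ℤ) + 1 + q - (p + 1) + 1) = q + 1 by ring]
  push_cast [Nat.factorial_succ]
  constructor
  · rw [← Real.sqrt_mul (by positivity),
      show ((q : ℝ) + 1) * (p + 1) * ((p + 1) * p.factorial * q.factorial) =
        (p + 1) ^ 2 * (p.factorial * ((q + 1) * q.factorial)) by ring,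
      Real.sqrt_mul (by positivity), Real.sqrt_sq (by positivity)]
  · rw [← Real.sqrt_mul (by positivity),
      show ((q : ℝ) + 1) * (p + 1) * (p.factorial * ((q + 1) * q.factorial)) =
        (q + 1) ^ 2 * ((p + 1) * p.factorial * q.factorial) by ring,
      Real.sqrt_mul (by positivity), Real.sqrt_sq (by positivity)]

/-- Multiplied by the square roots of factorials, the ladder factors become the linear coefficients
of `racahSum_lower`. At the ends of the range, where that absorption fails, the Racah sum itself
vanishes. -/
theorem cgInt_lower {J₁ J₂ J : ℕ} {k₁ k₂ k : ℤ} (h₁ : 0 ≤ k₁) (h₁' : k₁ ≤ J₁) (h₂ : 0 ≤ k₂)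
    (h₂' : k₂ ≤ J₂) (h : 0 ≤ k) (h' : k ≤ J) :
    ladder J₁ (k₁ + 1) * cgInt J₁ J₂ J (k₁ + 1) k₂ k +
      ladder J₂ (k₂ + 1) * cgInt J₁ J₂ J k₁ (k₂ + 1) k =
      ladder J k * cgInt J₁ J₂ J k₁ k₂ (k - 1) := by
  unfold cgInt
  set a := (J₁ + J₂ - J) / 2 with ha
  by_cases hc : Triangle J₁ J₂ J ∧ k₁ + k₂ = k - 1 + a
  · rw [if_pos ⟨hc.1, by omega⟩, if_pos ⟨hc.1, by omega⟩, if_pos hc]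
    obtain ⟨⟨t1, t2, t3, r, hr⟩, hk⟩ := hc
    have hJ : (J₁ : ℤ) + J₂ - J = 2 * a := by omega
    have e1 : ladder J₁ (k₁ + 1) * rootFact J₁ (k₁ + 1) *
        racahSum a (J₁ - (k₁ + 1)) k₂ (k₁ + 1 - a) (J₂ - k₂ - a) =
        ((k₁ + 1 : ℤ) : ℝ) * rootFact J₁ k₁ *
          racahSum a (J₁ - (k₁ + 1)) k₂ (k₁ + 1 - a) (J₂ - k₂ - a) := by
      by_cases hlt : k₁ + 1 ≤ J₁
      · rw [(ladder_mul_rootFact (by omega) hlt).1, add_sub_cancel_right]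
      · rw [racahSum_eq_zero (by omega)]; ring
    have e2 : ladder J₂ (k₂ + 1) * rootFact J₂ (k₂ + 1) *
        racahSum a (J₁ - k₁) (k₂ + 1) (k₁ - a) (J₂ - (k₂ + 1) - a) =
        ((k₂ + 1 : ℤ) : ℝ) * rootFact J₂ k₂ *
          racahSum a (J₁ - k₁) (k₂ + 1) (k₁ - a) (J₂ - (k₂ + 1) - a) := by
      by_cases hlt : k₂ + 1 ≤ J₂
      · rw [(ladder_mul_rootFact (by omega) hlt).1, add_sub_cancel_right]
      · rw [racahSum_eq_zero (by omega)]; ring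
    have e3 : ladder J k * rootFact J (k - 1) *
        racahSum a (J₁ - k₁) k₂ (k₁ - a) (J₂ - k₂ - a) =
        ((J - k + 1 : ℤ) : ℝ) * rootFact J k *
          racahSum a (J₁ - k₁) k₂ (k₁ - a) (J₂ - k₂ - a) := by
      by_cases hlt : 0 < k
      · rw [(ladder_mul_rootFact hlt h').2]
      · rw [racahSum_eq_zero (by omega)]; ring
    have key := racahSum_lower a (J₁ - k₁) k₂ (k₁ - a) (J₂ - k₂ - a)
    rw [show k₁ - a + a + 1 = k₁ + 1 by ring, show (J₁ : ℤ) - k₁ - 1 = J₁ - (k₁ + 1) by ring,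
      show k₁ - (a : ℤ) + 1 = k₁ + 1 - a by ring,
      show (J₂ : ℤ) - k₂ - a - 1 = J₂ - (k₂ + 1) - a by ring,
      show (J₁ : ℤ) - k₁ + (J₂ - k₂ - a) = J - k + 1 by omega] at key
    linear_combination racahNorm J₁ J₂ J * (rootFact J₂ k₂ * rootFact J k * e1 +
      rootFact J₁ k₁ * rootFact J k * e2 - rootFact J₁ k₁ * rootFact J₂ k₂ * e3 +
      rootFact J₁ k₁ * rootFact J₂ k₂ * rootFact J k * key)
  · rw [if_neg (fun hh => hc ⟨hh.1, by omega⟩), if_neg (fun hh => hc ⟨hh.1, by omega⟩),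
      if_neg hc]
    ring

theorem cgInt_raise {J₁ J₂ J : ℕ} {k₁ k₂ k : ℤ} (h₁ : 0 ≤ k₁) (h₁' : k₁ ≤ J₁) (h₂ : 0 ≤ k₂)
    (h₂' : k₂ ≤ J₂) (h : 0 ≤ k) (h' : k ≤ J) :
    ladder J₁ k₁ * cgInt J₁ J₂ J (k₁ - 1) k₂ k +
      ladder J₂ k₂ * cgInt J₁ J₂ J k₁ (k₂ - 1) k =
      ladder J (k + 1) * cgInt J₁ J₂ J k₁ k₂ (k + 1) := by
  unfold cgInt
  set a := (J₁ + J₂ - J) / 2 with ha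
  by_cases hc : Triangle J₁ J₂ J ∧ k₁ + k₂ = k + 1 + a
  · rw [if_pos ⟨hc.1, by omega⟩, if_pos ⟨hc.1, by omega⟩, if_pos hc]
    obtain ⟨⟨t1, t2, t3, r, hr⟩, hk⟩ := hc
    have hJ : (J₁ : ℤ) + J₂ - J = 2 * a := by omega
    have e1 : ladder J₁ k₁ * rootFact J₁ (k₁ - 1) *
        racahSum a (J₁ - (k₁ - 1)) k₂ (k₁ - 1 - a) (J₂ - k₂ - a) =
        ((J₁ - k₁ + 1 : ℤ) : ℝ) * rootFact J₁ k₁ *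
          racahSum a (J₁ - (k₁ - 1)) k₂ (k₁ - 1 - a) (J₂ - k₂ - a) := by
      by_cases hlt : 0 < k₁
      · rw [(ladder_mul_rootFact (by omega) h₁').2]
      · rw [racahSum_eq_zero (by omega)]; ring
    have e2 : ladder J₂ k₂ * rootFact J₂ (k₂ - 1) *
        racahSum a (J₁ - k₁) (k₂ - 1) (k₁ - a) (J₂ - (k₂ - 1) - a) =
        ((J₂ - k₂ + 1 : ℤ) : ℝ) * rootFact J₂ k₂ *
          racahSum a (J₁ - k₁) (k₂ - 1) (k₁ - a) (J₂ - (k₂ - 1) - a) := by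
      by_cases hlt : 0 < k₂
      · rw [(ladder_mul_rootFact (by omega) h₂').2]
      · rw [racahSum_eq_zero (by omega)]; ring
    have e3 : ladder J (k + 1) * rootFact J (k + 1) *
        racahSum a (J₁ - k₁) k₂ (k₁ - a) (J₂ - k₂ - a) =
        ((k + 1 : ℤ) : ℝ) * rootFact J k *
          racahSum a (J₁ - k₁) k₂ (k₁ - a) (J₂ - k₂ - a) := by
      by_cases hlt : k + 1 ≤ J
      · rw [(ladder_mul_rootFact (by omega) hlt).1, add_sub_cancel_right]
      · rw [racahSum_eq_zero (by omega)]; ring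
    have key := racahSum_raise a (J₁ - k₁) k₂ (k₁ - a) (J₂ - k₂ - a)
    rw [show (J₂ : ℤ) - k₂ - a + a + 1 = J₂ - k₂ + 1 by ring,
      show (J₁ : ℤ) - k₁ + 1 = J₁ - (k₁ - 1) by ring,
      show k₁ - (a : ℤ) - 1 = k₁ - 1 - a by ring,
      show (J₂ : ℤ) - k₂ - a + 1 = J₂ - (k₂ - 1) - a by ring,
      show k₂ + (k₁ - (a : ℤ)) = k + 1 by omega,
      show (J₁ : ℤ) - (k₁ - 1) = J₁ - k₁ + 1 by ring] at key
    rw [show (J₁ : ℤ) - (k₁ - 1) = J₁ - k₁ + 1 by ring] at e1 ⊢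
    linear_combination racahNorm J₁ J₂ J * (rootFact J₂ k₂ * rootFact J k * e1 +
      rootFact J₁ k₁ * rootFact J k * e2 - rootFact J₁ k₁ * rootFact J₂ k₂ * e3 +
      rootFact J₁ k₁ * rootFact J₂ k₂ * rootFact J k * key)
  · rw [if_neg (fun hh => hc ⟨hh.1, by omega⟩), if_neg (fun hh => hc ⟨hh.1, by omega⟩),
      if_neg hc]
    ring

/-- The raising operator as a real matrix. -/
def raising (J : ℕ) : Matrix (Fin (J + 1)) (Fin (J + 1)) ℝ :=
  Matrix.of fun k l => if (k : ℕ) = l + 1 then ladder J (k : ℕ) else 0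

theorem sum_raising_mul {J : ℕ} (k : Fin (J + 1)) (X : ℤ → ℝ) :
    ∑ l : Fin (J + 1), raising J k l * X (l : ℕ) = ladder J (k : ℕ) * X ((k : ℕ) - 1) := by
  by_cases hk : (k : ℕ) = 0
  · rw [hk, Nat.cast_zero, ladder_zero, zero_mul]
    refine Finset.sum_eq_zero fun l _ => ?_
    rw [raising, Matrix.of_apply, if_neg (by omega), zero_mul]
  · rw [Finset.sum_eq_single (⟨(k : ℕ) - 1, by omega⟩ : Fin (J + 1))]
    · rw [raising, Matrix.of_apply, if_pos (by simp; omega)]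
      simp only
      rw [Nat.cast_sub (by omega), Nat.cast_one]
    · intro l _ hl
      rw [raising, Matrix.of_apply, if_neg, zero_mul]
      intro h
      exact hl (Fin.ext (by simp; omega))
    · simp

theorem sum_mul_raising {J : ℕ} (k : Fin (J + 1)) (X : ℤ → ℝ) :
    ∑ l : Fin (J + 1), raising J l k * X (l : ℕ) =
      ladder J ((k : ℕ) + 1) * X ((k : ℕ) + 1) := by
  by_cases hk : (k : ℕ) = J
  · rw [hk, ladder_top, zero_mul]
    refine Finset.sum_eq_zero fun l _ => ?_
    rw [raising, Matrix.of_apply, if_neg (by omega), zero_mul]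
  · rw [Finset.sum_eq_single (⟨(k : ℕ) + 1, by omega⟩ : Fin (J + 1))]
    · rw [raising, Matrix.of_apply, if_pos (by simp)]
      push_cast
      rfl
    · intro l _ hl
      rw [raising, Matrix.of_apply, if_neg, zero_mul]
      intro h
      exact hl (Fin.ext (by simp; omega))
    · simp

/-- The Clebsch-Gordan coefficients intertwine the lowering operators. -/
theorem cg_lower (J₁ J₂ J : ℕ) (k₁ : Fin (J₁ + 1)) (k₂ : Fin (J₂ + 1)) (k : Fin (J + 1)) :
    ∑ l, raising J₁ l k₁ * cg J₁ J₂ J l k₂ k + ∑ l, raising J₂ l k₂ * cg J₁ J₂ J k₁ l k =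
      ∑ l, raising J k l * cg J₁ J₂ J k₁ k₂ l := by
  simp only [cg_eq_cgInt]
  rw [sum_mul_raising k₁ (fun l => cgInt J₁ J₂ J l (k₂ : ℕ) (k : ℕ)),
    sum_mul_raising k₂ (fun l => cgInt J₁ J₂ J (k₁ : ℕ) l (k : ℕ)),
    sum_raising_mul k (fun l => cgInt J₁ J₂ J (k₁ : ℕ) (k₂ : ℕ) l)]
  have := k₁.is_le
  have := k₂.is_le
  have := k.is_le
  exact cgInt_lower (by omega) (by omega) (by omega) (by omega) (by omega) (by omega)

/-- The Clebsch-Gordan coefficients intertwine the raising operators. -/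
theorem cg_raise (J₁ J₂ J : ℕ) (k₁ : Fin (J₁ + 1)) (k₂ : Fin (J₂ + 1)) (k : Fin (J + 1)) :
    ∑ l, raising J₁ k₁ l * cg J₁ J₂ J l k₂ k + ∑ l, raising J₂ k₂ l * cg J₁ J₂ J k₁ l k =
      ∑ l, raising J l k * cg J₁ J₂ J k₁ k₂ l := by
  simp only [cg_eq_cgInt]
  rw [sum_raising_mul k₁ (fun l => cgInt J₁ J₂ J l (k₂ : ℕ) (k : ℕ)),
    sum_raising_mul k₂ (fun l => cgInt J₁ J₂ J (k₁ : ℕ) l (k : ℕ)),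
    sum_mul_raising k (fun l => cgInt J₁ J₂ J (k₁ : ℕ) (k₂ : ℕ) l)]
  have := k₁.is_le
  have := k₂.is_le
  have := k.is_le
  exact cgInt_raise (by omega) (by omega) (by omega) (by omega) (by omega) (by omega)

theorem cg_eq_zero_of_weight {J₁ J₂ J : ℕ} {k₁ : Fin (J₁ + 1)} {k₂ : Fin (J₂ + 1)}
    {k : Fin (J + 1)} (h : (2 * (k₁ : ℤ) - J₁) + (2 * (k₂ : ℤ) - J₂) ≠ 2 * (k : ℤ) - J) :
    cg J₁ J₂ J k₁ k₂ k = 0 := by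
  rw [cg, if_neg (fun hh => h hh.1)]

end

end SpinChain

/-! ### Orthonormality and completeness of the Clebsch–Gordan coefficients. -/

namespace SpinChain

open scoped Matrix Kronecker

noncomputable section

/-- The Clebsch-Gordan coefficients as a matrix from spin `J / 2` to the tensor product. -/
def cgMatrix (J₁ J₂ J : ℕ) : Matrix (Fin (J₁ + 1) × Fin (J₂ + 1)) (Fin (J + 1)) ℝ :=
  Matrix.of fun x k => cg J₁ J₂ J x.1 x.2 k

/-- The raising operator of the tensor product of two spins. -/
def raisingProd (J₁ J₂ : ℕ) :
    Matrix (Fin (J₁ + 1) × Fin (J₂ + 1)) (Fin (J₁ + 1) × Fin (J₂ + 1)) ℝ :=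
  raising J₁ ⊗ₖ (1 : Matrix (Fin (J₂ + 1)) (Fin (J₂ + 1)) ℝ) +
    (1 : Matrix (Fin (J₁ + 1)) (Fin (J₁ + 1)) ℝ) ⊗ₖ raising J₂

theorem raisingProd_mul_cgMatrix (J₁ J₂ J : ℕ) :
    raisingProd J₁ J₂ * cgMatrix J₁ J₂ J = cgMatrix J₁ J₂ J * raising J := by
  ext ⟨k₁, k₂⟩ k
  simp only [Matrix.mul_apply, raisingProd, cgMatrix, Matrix.add_apply, Matrix.kroneckerMap_apply,
    Matrix.of_apply, Matrix.one_apply, Fintype.sum_prod_type, mul_ite, ite_mul, mul_one, one_mul,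
    mul_zero, zero_mul, add_mul, Finset.sum_add_distrib, Finset.sum_ite_eq, Finset.mem_univ, if_true]
  rw [Finset.sum_comm (f := fun x y => if k₁ = x then _ else _)]
  simp only [Finset.sum_ite_eq, Finset.mem_univ, if_true]
  rw [cg_raise]
  exact Finset.sum_congr rfl fun _ _ => mul_comm _ _

theorem raisingProd_transpose_mul_cgMatrix (J₁ J₂ J : ℕ) :
    (raisingProd J₁ J₂)ᵀ * cgMatrix J₁ J₂ J = cgMatrix J₁ J₂ J * (raising J)ᵀ := by
  ext ⟨k₁, k₂⟩ k
  simp only [Matrix.mul_apply, raisingProd, cgMatrix, Matrix.add_apply, Matrix.kroneckerMap_apply,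
    Matrix.of_apply, Matrix.one_apply, Fintype.sum_prod_type, mul_ite, ite_mul, mul_one, one_mul,
    mul_zero, zero_mul, add_mul, Finset.sum_add_distrib, Finset.sum_ite_eq', Finset.mem_univ,
    if_true, Matrix.transpose_apply]
  rw [Finset.sum_comm (f := fun x y => if x = k₁ then _ else _)]
  simp only [Finset.sum_ite_eq', Finset.mem_univ, if_true]
  rw [cg_lower]
  exact Finset.sum_congr rfl fun _ _ => mul_comm _ _

/-- The raising operator of the tensor product is moved from one factor to the other through its
transpose; this is the input to the Schur-type arguments below. -/
theorem cgMatrix_gram_mul_raising (J₁ J₂ J J' : ℕ) :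
    ((cgMatrix J₁ J₂ J)ᵀ * cgMatrix J₁ J₂ J') * raising J' =
      raising J * ((cgMatrix J₁ J₂ J)ᵀ * cgMatrix J₁ J₂ J') := by
  rw [Matrix.mul_assoc, ← raisingProd_mul_cgMatrix, ← Matrix.mul_assoc, ← Matrix.mul_assoc]
  congr 1
  have := congrArg Matrix.transpose (raisingProd_transpose_mul_cgMatrix J₁ J₂ J)
  simpa [Matrix.transpose_mul] using this

theorem cgMatrix_gram_mul_raising_transpose (J₁ J₂ J J' : ℕ) :
    ((cgMatrix J₁ J₂ J)ᵀ * cgMatrix J₁ J₂ J') * (raising J')ᵀ =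
      (raising J)ᵀ * ((cgMatrix J₁ J₂ J)ᵀ * cgMatrix J₁ J₂ J') := by
  have := congrArg Matrix.transpose (cgMatrix_gram_mul_raising J₁ J₂ J' J)
  simpa [Matrix.transpose_mul, Matrix.mul_assoc] using this.symm

theorem raising_mul_apply {J : ℕ} {ι : Type*} (X : Matrix (Fin (J + 1)) ι ℝ) (k : Fin J) (i : ι) :
    (raising J * X) k.succ i = ladder J ((k : ℕ) + 1) * X k.castSucc i := by
  rw [Matrix.mul_apply, Finset.sum_eq_single k.castSucc]
  · simp [raising]
  · intro l _ hl
    rw [raising, Matrix.of_apply, if_neg, zero_mul]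
    intro h
    exact hl (Fin.ext (by simp at h ⊢; omega))
  · simp

theorem mul_raising_apply {J : ℕ} {ι : Type*} (X : Matrix ι (Fin (J + 1)) ℝ) (k : Fin J) (i : ι) :
    (X * raising J) i k.castSucc = X i k.succ * ladder J ((k : ℕ) + 1) := by
  rw [Matrix.mul_apply, Finset.sum_eq_single k.succ]
  · simp [raising]
  · intro l _ hl
    rw [raising, Matrix.of_apply, if_neg, mul_zero]
    intro h
    exact hl (Fin.ext (by simp at h ⊢; omega))
  · simp

theorem sum_raising_apply_zero {J : ℕ} (f : Fin (J + 1) → ℝ) :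
    ∑ l, raising J 0 l * f l = 0 :=
  Finset.sum_eq_zero fun l _ => by
    rw [raising, Matrix.of_apply, if_neg (by simp), zero_mul]

theorem sum_raising_castSucc {J : ℕ} (k : Fin J) (f : Fin (J + 1) → ℝ) :
    ∑ l, raising J l k.castSucc * f l = ladder J ((k : ℕ) + 1) * f k.succ := by
  have h := mul_raising_apply (Matrix.of fun (_ : Unit) l => f l) k ()
  rw [Matrix.mul_apply] at h
  simp only [Matrix.of_apply] at h
  rw [mul_comm (ladder _ _), ← h]
  exact Finset.sum_congr rfl fun _ _ => mul_comm _ _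

theorem raising_mul_transpose (J : ℕ) :
    raising J * (raising J)ᵀ =
      Matrix.diagonal fun k : Fin (J + 1) => ((J - (k : ℕ) + 1 : ℤ) : ℝ) * ((k : ℕ) : ℤ) := by
  ext k l
  rw [Matrix.mul_apply, Matrix.diagonal_apply]
  split_ifs with h
  · subst h
    simp only [Matrix.transpose_apply]
    have hle := k.is_le
    rw [← ladder_mul_self (by omega) (by omega)]
    by_cases hk : (k : ℕ) = 0
    · rw [hk, Nat.cast_zero, ladder_zero, mul_zero]
      refine Finset.sum_eq_zero fun x _ => ?_
      rw [raising, Matrix.of_apply, if_neg (by omega), zero_mul]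
    · rw [Finset.sum_eq_single (⟨(k : ℕ) - 1, by omega⟩ : Fin (J + 1))]
      · rw [raising, Matrix.of_apply, if_pos (by simp; omega)]
      · intro x _ hx
        rw [raising, Matrix.of_apply, if_neg, zero_mul]
        intro h
        exact hx (Fin.ext (by simp; omega))
      · simp
  · refine Finset.sum_eq_zero fun x _ => ?_
    simp only [raising, Matrix.transpose_apply, Matrix.of_apply]
    split_ifs with h1 h2 <;> try simp
    exact absurd (Fin.ext (by omega)) h

theorem cgMatrix_gram_eq_zero_of_weight {J₁ J₂ J J' : ℕ} {k : Fin (J + 1)} {k' : Fin (J' + 1)}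
    (h : 2 * (k : ℤ) - J ≠ 2 * (k' : ℤ) - J') :
    ((cgMatrix J₁ J₂ J)ᵀ * cgMatrix J₁ J₂ J') k k' = 0 := by
  rw [Matrix.mul_apply]
  refine Finset.sum_eq_zero fun x _ => ?_
  simp only [cgMatrix, Matrix.transpose_apply, Matrix.of_apply]
  by_cases h1 : (2 * (x.1 : ℤ) - J₁) + (2 * (x.2 : ℤ) - J₂) = 2 * (k : ℤ) - J
  · rw [cg_eq_zero_of_weight (k := k') (by omega), mul_zero]
  · rw [cg_eq_zero_of_weight h1, zero_mul]

/-- The Gram matrix intertwines the diagonal matrices S⁺S⁻ of the two spins, so an entry can be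
nonzero only where their eigenvalues agree. At equal weight they agree only for J = J'. -/
theorem cgMatrix_gram_of_ne (J₁ J₂ : ℕ) {J J' : ℕ} (hne : J ≠ J') :
    (cgMatrix J₁ J₂ J)ᵀ * cgMatrix J₁ J₂ J' = 0 := by
  set G := (cgMatrix J₁ J₂ J)ᵀ * cgMatrix J₁ J₂ J' with hG
  have h : G * (raising J' * (raising J')ᵀ) = raising J * (raising J)ᵀ * G := by
    rw [← Matrix.mul_assoc, hG, cgMatrix_gram_mul_raising, Matrix.mul_assoc,
      cgMatrix_gram_mul_raising_transpose, Matrix.mul_assoc]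
  rw [raising_mul_transpose, raising_mul_transpose] at h
  ext k k'
  rw [Matrix.zero_apply]
  by_cases hw : 2 * (k : ℤ) - J = 2 * (k' : ℤ) - J'
  · have h2 := congrFun (congrFun h k) k'
    rw [Matrix.mul_diagonal, Matrix.diagonal_mul] at h2
    have h3 : G k k' * (((J - (k : ℕ) + 1) * (k : ℕ) - (J' - (k' : ℕ) + 1) * (k' : ℕ) : ℤ) : ℝ)
        = 0 := by push_cast at *; linear_combination -h2
    rcases mul_eq_zero.mp h3 with h4 | h4
    · exact h4
    · exfalso
      have h5 : ((J : ℤ) - (k : ℕ) + 1) * (k : ℕ) - (J' - (k' : ℕ) + 1) * (k' : ℕ) = 0 := by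
        exact_mod_cast h4
      -- With 2m = 2k - J, 4(J - k + 1)k = (J + 1)² - (2m - 1)²; at equal m the difference of two
      -- such values is (J + 1)² - (J' + 1)².
      have h6 : ((J : ℤ) - J') * (J + J' + 2) = 0 := by
        have e1 : ((J : ℤ) + J' + 2 * (k : ℕ) - 2 * (k' : ℕ)) = 2 * J := by omega
        have e2 : (2 * (k : ℤ) - J) * (2 * (k : ℤ) - J) =
          (2 * (k' : ℤ) - J') * (2 * (k' : ℤ) - J') := by rw [hw]
        linear_combination 4 * h5 + e2 - 2 * hw
      rcases mul_eq_zero.mp h6 with h7 | h7 <;> omega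
  · exact cgMatrix_gram_eq_zero_of_weight hw

/-- Compare the coefficients of X^a in (1 - X)^(-(b+1)) (1 - X)^(-(c+1)) = (1 - X)^(-(b+c+2)). -/
theorem sum_choose_mul_choose (a b c : ℕ) :
    ∑ n ∈ Finset.range (a + 1), (b + (a - n)).choose b * (c + n).choose c =
      (b + c + 1 + a).choose (b + c + 1) := by
  have h1 := PowerSeries.mk_one_pow_eq_mk_choose_add ℤ b
  have h2 := PowerSeries.mk_one_pow_eq_mk_choose_add ℤ c
  have h3 := PowerSeries.mk_one_pow_eq_mk_choose_add ℤ (b + c + 1)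
  rw [show b + c + 1 + 1 = c + 1 + (b + 1) by ring, pow_add, h1, h2] at h3
  have h4 := congrArg (PowerSeries.coeff a) h3
  rw [PowerSeries.coeff_mul, PowerSeries.coeff_mk,
    Finset.Nat.sum_antidiagonal_eq_sum_range_succ_mk] at h4
  simp only [PowerSeries.coeff_mk] at h4
  have h5 : ((∑ n ∈ Finset.range (a + 1), (b + (a - n)).choose b * (c + n).choose c : ℕ) : ℤ) =
      ((b + c + 1 + a).choose (b + c + 1) : ℕ) := by
    rw [← h4]
    push_cast
    exact Finset.sum_congr rfl fun _ _ => mul_comm _ _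
  exact_mod_cast h5

/-- At the highest weight the bounds i ≤ α = n and i ≥ -δ = n leave a single term. -/
theorem racahSum_top (a b c n : ℕ) (hn : n ≤ a) :
    racahSum a n (c + n) (b - n) (-n) =
      (-1) ^ n * (((n.factorial : ℝ))⁻¹ * ((a - n).factorial : ℝ)⁻¹ * (c.factorial : ℝ)⁻¹ *
        (b.factorial : ℝ)⁻¹) := by
  unfold racahSum
  rw [Finset.sum_eq_single n]
  · unfold racahTerm
    rw [show (a : ℤ) - n = ((a - n : ℕ) : ℤ) by omega, show (n : ℤ) - n = ((0 : ℕ) : ℤ) by simp,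
      show (c : ℤ) + n - n = (c : ℤ) by ring, show (b : ℤ) - n + n = b by ring,
      show -(n : ℤ) + n = ((0 : ℕ) : ℤ) by simp]
    simp only [invFact_natCast, Nat.factorial_zero, Nat.cast_one, inv_one]
    ring
  · intro i _ hi
    rw [racahTerm_eq_zero (by omega), mul_zero]
  · intro h
    exact absurd (Finset.mem_range.mpr (by omega)) h

/-- Writing the spins as a + b, a + c, b + c solves the triangle conditions; the squared
coefficients become the summands of `sum_choose_mul_choose` over their total. -/
theorem cg_top_sq (a b c n : ℕ) (hn : n ≤ a) :
    cg (a + b) (a + c) (b + c) ⟨a + b - n, by omega⟩ ⟨c + n, by omega⟩ ⟨b + c, by omega⟩ ^ 2 =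
      ((b + (a - n)).choose b * (c + n).choose c : ℕ) /
        ((b + c + 1 + a).choose (b + c + 1) : ℕ) := by
  rw [cg_eq_cgInt, cgInt, show (a + b + (a + c) - (b + c)) / 2 = a by omega,
    if_pos ⟨⟨by omega, by omega, by omega, ⟨a + b + c, by ring⟩⟩, by simp only; omega⟩]
  simp only
  rw [show ((a + b : ℕ) : ℤ) - (a + b - n : ℕ) = n by omega,
    show ((c + n : ℕ) : ℤ) = c + n by push_cast; rfl,
    show ((a + b - n : ℕ) : ℤ) - a = b - n by omega,
    show ((a + c : ℕ) : ℤ) - (c + n) - a = -n by push_cast; ring, racahSum_top a b c n hn]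
  unfold racahNorm rootFact
  rw [show (a + b + (a + c) - (b + c)) / 2 = a by omega,
    show (a + b + (b + c) - (a + c)) / 2 = b by omega,
    show (a + c + (b + c) - (a + b)) / 2 = c by omega,
    show (a + b + (a + c) + (b + c)) / 2 = a + b + c by omega,
    show (((a + b - n : ℕ) : ℤ)).toNat = b + (a - n) by omega,
    show (((a + b : ℕ) : ℤ) - (a + b - n : ℕ)).toNat = n by omega,
    show ((c : ℤ) + n).toNat = c + n by omega,
    show (((a + c : ℕ) : ℤ) - (c + n)).toNat = a - n by omega,
    show (((b + c : ℕ) : ℤ)).toNat = b + c by omega,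
    show (((b + c : ℕ) : ℤ) - (b + c : ℕ)).toNat = 0 by omega]
  have hsq : ((-1 : ℝ) ^ n) ^ 2 = 1 := by rw [← pow_mul, mul_comm, pow_mul]; simp
  rw [mul_pow, mul_pow, mul_pow, mul_pow, mul_pow, hsq, Real.sq_sqrt (by positivity),
    Real.sq_sqrt (by positivity), Real.sq_sqrt (by positivity), Real.sq_sqrt (by positivity)]
  have f1 := Nat.add_choose_mul_factorial_mul_factorial b (a - n)
  have f2 := Nat.add_choose_mul_factorial_mul_factorial c n
  have f3 := Nat.add_choose_mul_factorial_mul_factorial (b + c + 1) a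
  have f4 := Nat.factorial_succ (b + c)
  rw [← Nat.choose_symm_add] at f1 f2 f3
  rw [show b + c + 1 + a = a + b + c + 1 by ring] at *
  have g1 : (((b + (a - n)).choose b : ℕ) : ℝ) =
      (b + (a - n)).factorial / (b.factorial * (a - n).factorial) := by
    rw [eq_div_iff (by positivity), ← f1]; push_cast; ring
  have g2 : (((c + n).choose c : ℕ) : ℝ) =
      (c + n).factorial / (c.factorial * n.factorial) := by
    rw [eq_div_iff (by positivity), ← f2]; push_cast; ring
  have g3 : (((a + b + c + 1).choose (b + c + 1) : ℕ) : ℝ) =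
      (a + b + c + 1).factorial / ((b + c + 1).factorial * a.factorial) := by
    rw [eq_div_iff (by positivity), ← f3]; push_cast; ring
  push_cast
  rw [g1, g2, g3, f4]
  push_cast
  have : (b + (a - n)).factorial ≠ 0 := by positivity
  field_simp
  simp

theorem sum_cg_top_sq {J₁ J₂ J : ℕ} (h : Triangle J₁ J₂ J) :
    ∑ x : Fin (J₁ + 1) × Fin (J₂ + 1), cg J₁ J₂ J x.1 x.2 (Fin.last J) ^ 2 = 1 := by
  obtain ⟨a, b, c, rfl, rfl, rfl⟩ : ∃ a b c, J₁ = a + b ∧ J₂ = a + c ∧ J = b + c := by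
    obtain ⟨h1, h2, h3, r, hr⟩ := h
    exact ⟨(J₁ + J₂ - J) / 2, (J₁ + J - J₂) / 2, (J₂ + J - J₁) / 2, by omega, by omega, by omega⟩
  have hb : ∀ n ∈ Finset.range (a + 1), n ≤ a := fun n hn => by
    have := Finset.mem_range.mp hn; omega
  rw [← Finset.sum_of_injOn (s := Finset.range (a + 1))
    (f := fun n => ((b + (a - n)).choose b * (c + n).choose c : ℕ) /
        (((b + c + 1 + a).choose (b + c + 1) : ℕ) : ℝ))
    -- The pairs of highest total weight. The remainder only makes the index well-formed for all n;
    -- it changes nothing for n ≤ a.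
    (fun n => ((⟨a + b - n, by omega⟩ : Fin (a + b + 1)),
      (⟨(c + n) % (a + c + 1), Nat.mod_lt _ (by omega)⟩ : Fin (a + c + 1))))]
  · rw [← Finset.sum_div, ← Nat.cast_sum, sum_choose_mul_choose]
    exact div_self (by exact_mod_cast (Nat.choose_pos (by omega)).ne')
  · intro n hn n' hn' hh
    have h1 := hb n hn
    have h2 := hb n' hn'
    simp only [Prod.mk.injEq, Fin.mk.injEq] at hh
    omega
  · simp
  · rintro ⟨k₁, k₂⟩ - hx
    rw [cg_eq_zero_of_weight, sq, mul_zero]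
    intro hw
    simp only [Fin.val_last] at hw
    push_cast at hw
    have b1 := k₁.is_le
    have b2 := k₂.is_le
    refine hx ⟨a + b - k₁, Finset.mem_coe.mpr (Finset.mem_range.mpr (by omega)), ?_⟩
    simp only [Prod.mk.injEq]
    refine ⟨Fin.ext (by simp only; omega), Fin.ext ?_⟩
    simp only
    rw [Nat.mod_eq_of_lt (by omega)]
    omega
  · intro n hn
    rw [← cg_top_sq a b c n (hb n hn)]
    have := hb n hn
    have e : (c + n) % (a + c + 1) = c + n := Nat.mod_eq_of_lt (by omega)
    congr 2
    exact Fin.ext e.symm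

/-- Commuting with the raising operator forces neighbouring diagonal entries to agree, so all equal
the norm of the top state. Off the diagonal the weights differ. -/
theorem cgMatrix_gram_self {J₁ J₂ J : ℕ} (h : Triangle J₁ J₂ J) :
    (cgMatrix J₁ J₂ J)ᵀ * cgMatrix J₁ J₂ J = 1 := by
  set G := (cgMatrix J₁ J₂ J)ᵀ * cgMatrix J₁ J₂ J with hG
  have hdiag : ∀ k, G k k = 1 := by
    refine Fin.reverseInduction ?_ ?_
    · rw [hG, Matrix.mul_apply, ← sum_cg_top_sq h]
      exact Finset.sum_congr rfl fun x _ => by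
        simp only [cgMatrix, Matrix.transpose_apply, Matrix.of_apply]; ring
    · intro k ih
      have h1 := congrFun (congrFun (cgMatrix_gram_mul_raising J₁ J₂ J J) k.succ) k.castSucc
      rw [mul_raising_apply, raising_mul_apply, ← hG, ih, one_mul] at h1
      have hk := k.is_lt
      have hp : 0 < ladder J ((k : ℕ) + 1) := ladder_pos (by omega) (by omega)
      exact mul_left_cancel₀ hp.ne' (by linarith)
  ext k l
  rw [Matrix.one_apply]
  split_ifs with hkl
  · rw [← hkl]; exact hdiag k
  · exact cgMatrix_gram_eq_zero_of_weight fun hh => hkl (Fin.ext (by omega))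

theorem cgMatrix_gram_apply (J₁ J₂ J J' : ℕ) (k : Fin (J + 1)) (k' : Fin (J' + 1)) :
    ((cgMatrix J₁ J₂ J)ᵀ * cgMatrix J₁ J₂ J') k k' =
      ∑ k₁, ∑ k₂, cg J₁ J₂ J k₁ k₂ k * cg J₁ J₂ J' k₁ k₂ k' := by
  rw [Matrix.mul_apply, Fintype.sum_prod_type]
  rfl

/-- Completeness of the coupled basis of two spins `S`. -/
theorem sum_cg_mul_cg (S : ℕ) (x y : Fin (2 * S + 1) × Fin (2 * S + 1)) :
    ∑ s : Fin (2 * S + 1), ∑ k : Fin (2 * (s : ℕ) + 1),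
      cg (2 * S) (2 * S) (2 * s) x.1 x.2 k * cg (2 * S) (2 * S) (2 * s) y.1 y.2 k =
      if x = y then 1 else 0 := by
  let U : Matrix (Fin (2 * S + 1) × Fin (2 * S + 1)) (Σ s : Fin (2 * S + 1), Fin (2 * (s : ℕ) + 1))
    ℝ := Matrix.of fun x p => cgMatrix (2 * S) (2 * S) (2 * p.1) x p.2
  have hU : Uᵀ * U = 1 := by
    ext ⟨s, k⟩ ⟨t, l⟩
    change ((cgMatrix (2 * S) (2 * S) (2 * s))ᵀ * cgMatrix (2 * S) (2 * S) (2 * t)) k l = _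
    by_cases hst : s = t
    · subst hst
      have hs := s.is_le
      rw [cgMatrix_gram_self ⟨by omega, by omega, by omega, ⟨2 * S + s, by ring⟩⟩,
        Matrix.one_apply, Matrix.one_apply]
      simp
    · rw [cgMatrix_gram_of_ne _ _ (fun h => hst (Fin.ext (by omega))), Matrix.one_apply,
        if_neg (fun h => hst (congrArg Sigma.fst h)), Matrix.zero_apply]
  have hcard : Fintype.card (Fin (2 * S + 1) × Fin (2 * S + 1)) =
      Fintype.card (Σ s : Fin (2 * S + 1), Fin (2 * (s : ℕ) + 1)) := by
    simp only [Fintype.card_prod, Fintype.card_fin, Fintype.card_sigma]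
    rw [Fin.sum_univ_eq_sum_range (fun s => 2 * s + 1)]
    have : ∀ n : ℕ, ∑ s ∈ Finset.range n, (2 * s + 1) = n * n := by
      intro n
      induction n with
      | zero => rfl
      | succ n ih => rw [Finset.sum_range_succ, ih]; ring
    rw [this]
  -- Since ∑ (2s + 1) over s ≤ 2S is (2S + 1)², the isometry `U` has as many columns as rows, so its
  -- left inverse is also a right inverse.
  have hU' : U * Uᵀ = 1 := (Matrix.mul_eq_one_comm_of_card_eq _ _ _ hcard.symm).mp hU
  have := congrFun (congrFun hU' x) y
  rw [Matrix.mul_apply, Fintype.sum_sigma, Matrix.one_apply] at this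
  exact this

end

end SpinChain

/-! ### Tensor operators on the virtual space, the renormalization condition and the isometry. -/

namespace SpinChain

open scoped Matrix

noncomputable section

namespace Model

variable (m : Model)

/-- The Kraus operators as real matrices. -/
def realKraus (M : Fin (2 * m.S + 1)) : Matrix m.VirtIndex m.VirtIndex ℝ :=
  Matrix.of fun x y => m.T x.1 y.1 * cg (m.virt x.1) (2 * m.S) (m.virt y.1) x.2 M y.2

theorem kraus_eq_map (M : Fin (2 * m.S + 1)) :
    m.kraus M = (m.realKraus M).map (algebraMap ℝ ℂ) := rfl

/-- The raising operator on the virtual space. -/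
def virtRaising : Matrix m.VirtIndex m.VirtIndex ℝ :=
  Matrix.blockDiagonal' fun a => raising (m.virt a)

/-- `D` transforms under the raising and lowering operators like the basis of spin `s / 2`. -/
def IsTensorOp {s : ℕ} (D : Fin (s + 1) → Matrix m.VirtIndex m.VirtIndex ℝ) : Prop :=
  ∀ k, m.virtRaising * D k + ∑ l, raising s k l • D l = D k * m.virtRaising ∧
    m.virtRaisingᵀ * D k + ∑ l, raising s l k • D l = D k * m.virtRaisingᵀ

variable {m}

theorem virtRaising_mul_apply (Y : Matrix m.VirtIndex m.VirtIndex ℝ) (a : Fin m.n)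
    (k : Fin (m.virt a + 1)) (y : m.VirtIndex) :
    (m.virtRaising * Y) ⟨a, k⟩ y = ∑ l, raising (m.virt a) k l * Y ⟨a, l⟩ y := by
  rw [Matrix.mul_apply, Fintype.sum_sigma, Finset.sum_eq_single a]
  · simp [virtRaising, Matrix.blockDiagonal'_apply_eq]
  · intro b _ hb
    refine Finset.sum_eq_zero fun l _ => ?_
    rw [virtRaising, Matrix.blockDiagonal'_apply_ne _ _ _ (Ne.symm hb), zero_mul]
  · simp

theorem virtRaising_transpose_mul_apply (Y : Matrix m.VirtIndex m.VirtIndex ℝ) (a : Fin m.n)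
    (k : Fin (m.virt a + 1)) (y : m.VirtIndex) :
    (m.virtRaisingᵀ * Y) ⟨a, k⟩ y = ∑ l, raising (m.virt a) l k * Y ⟨a, l⟩ y := by
  rw [Matrix.mul_apply, Fintype.sum_sigma, Finset.sum_eq_single a]
  · simp [virtRaising, Matrix.blockDiagonal'_apply_eq]
  · intro b _ hb
    refine Finset.sum_eq_zero fun l _ => ?_
    rw [Matrix.transpose_apply, virtRaising, Matrix.blockDiagonal'_apply_ne _ _ _ hb, zero_mul]
  · simp

theorem mul_virtRaising_apply (Y : Matrix m.VirtIndex m.VirtIndex ℝ) (a : Fin m.n)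
    (k : Fin (m.virt a + 1)) (x : m.VirtIndex) :
    (Y * m.virtRaising) x ⟨a, k⟩ = ∑ l, raising (m.virt a) l k * Y x ⟨a, l⟩ := by
  have := virtRaising_transpose_mul_apply Yᵀ a k x
  rw [← Matrix.transpose_mul] at this
  exact this

theorem mul_virtRaising_transpose_apply (Y : Matrix m.VirtIndex m.VirtIndex ℝ) (a : Fin m.n)
    (k : Fin (m.virt a + 1)) (x : m.VirtIndex) :
    (Y * m.virtRaisingᵀ) x ⟨a, k⟩ = ∑ l, raising (m.virt a) k l * Y x ⟨a, l⟩ := by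
  have := virtRaising_mul_apply Yᵀ a k x
  rw [← Matrix.transpose_transpose m.virtRaising, ← Matrix.transpose_mul] at this
  exact this

/-- On each block the weight `T a b` is a scalar, so this is the intertwining property of the
Clebsch–Gordan coefficients. -/
theorem isTensorOp_realKraus : m.IsTensorOp m.realKraus := by
  intro M
  constructor
  · ext ⟨a, k⟩ ⟨b, l⟩
    rw [Matrix.add_apply, virtRaising_mul_apply, mul_virtRaising_apply, Matrix.sum_apply]
    have h := cg_raise (m.virt a) (2 * m.S) (m.virt b) k M l
    simp only [realKraus, Matrix.smul_apply, Matrix.of_apply, smul_eq_mul, mul_left_comm _ (m.T a b),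
      ← Finset.mul_sum, ← mul_add, h]
  · ext ⟨a, k⟩ ⟨b, l⟩
    rw [Matrix.add_apply, virtRaising_transpose_mul_apply, mul_virtRaising_transpose_apply,
      Matrix.sum_apply]
    have h := cg_lower (m.virt a) (2 * m.S) (m.virt b) k M l
    simp only [realKraus, Matrix.smul_apply, Matrix.of_apply, smul_eq_mul, mul_left_comm _ (m.T a b),
      ← Finset.mul_sum, ← mul_add, h]

/-- The coupling of two families of operators to the spin `s / 2`. -/
def couple {r : ℕ} (s : ℕ) (D : Fin (r + 1) → Matrix m.VirtIndex m.VirtIndex ℝ)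
    (k : Fin (s + 1)) : Matrix m.VirtIndex m.VirtIndex ℝ :=
  ∑ i, ∑ j, cg r r s i j k • (D i * D j)

theorem sum_mul_sum_right {ι κ : Type*} [Fintype ι] [Fintype κ] (c W : ι → κ → ℝ)
    (ρ : κ → κ → ℝ) :
    ∑ i, ∑ j, c i j * ∑ l, ρ j l * W i l = ∑ i, ∑ j, (∑ l, ρ l j * c i l) * W i j := by
  refine Finset.sum_congr rfl fun i _ => ?_
  simp only [Finset.mul_sum, Finset.sum_mul]
  rw [Finset.sum_comm]
  exact Finset.sum_congr rfl fun _ _ => Finset.sum_congr rfl fun _ _ => by ring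

theorem sum_mul_sum_left {ι κ : Type*} [Fintype ι] [Fintype κ] (c W : ι → κ → ℝ)
    (ρ : ι → ι → ℝ) :
    ∑ i, ∑ j, c i j * ∑ l, ρ i l * W l j = ∑ i, ∑ j, (∑ l, ρ l i * c l j) * W i j := by
  rw [Finset.sum_comm, sum_mul_sum_right (fun j i => c i j) (fun j i => W i j), Finset.sum_comm]

/-- A bilinear expression intertwines a derivation if its coefficients do. -/
theorem couple_commutator {r s : ℕ} {D : Fin (r + 1) → Matrix m.VirtIndex m.VirtIndex ℝ}
    {P : Matrix m.VirtIndex m.VirtIndex ℝ} {ρ : Fin (r + 1) → Fin (r + 1) → ℝ}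
    {σ : Fin (s + 1) → Fin (s + 1) → ℝ} (hD : ∀ i, P * D i + ∑ l, ρ i l • D l = D i * P)
    (hc : ∀ i j k, ∑ l, ρ l i * cg r r s l j k + ∑ l, ρ l j * cg r r s i l k =
      ∑ l, σ k l * cg r r s i j l) (k : Fin (s + 1)) :
    P * couple s D k + ∑ l, σ k l • couple s D l = couple s D k * P := by
  have h1 : ∀ i j, P * (D i * D j) = D i * D j * P - ∑ l, ρ j l • (D i * D l) -
      ∑ l, ρ i l • (D l * D j) := by
    intro i j
    have e1 : P * D i = D i * P - ∑ l, ρ i l • D l := eq_sub_of_add_eq (hD i)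
    have e2 : P * D j = D j * P - ∑ l, ρ j l • D l := eq_sub_of_add_eq (hD j)
    rw [← Matrix.mul_assoc, e1, Matrix.sub_mul, Matrix.mul_assoc, e2, Matrix.mul_sub,
      Matrix.mul_assoc, Matrix.mul_sum, Matrix.sum_mul]
    simp only [Matrix.smul_mul, Matrix.mul_smul]
  have h2 : P * couple s D k = couple s D k * P -
      ((∑ i, ∑ j, cg r r s i j k • ∑ l, ρ j l • (D i * D l)) +
      ∑ i, ∑ j, cg r r s i j k • ∑ l, ρ i l • (D l * D j)) := by
    unfold couple
    simp only [Matrix.mul_sum, Matrix.sum_mul, Matrix.mul_smul, Matrix.smul_mul, h1, smul_sub,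
      Finset.sum_sub_distrib]
    abel
  -- Relabelling the sums moves ρ from the operators to the coefficients, transposing it; there `hc`
  -- applies.
  have h3 : ∑ l, σ k l • couple s D l =
      (∑ i, ∑ j, cg r r s i j k • ∑ l, ρ j l • (D i * D l)) +
      ∑ i, ∑ j, cg r r s i j k • ∑ l, ρ i l • (D l * D j) := by
    ext x y
    unfold couple
    simp only [Matrix.add_apply, Matrix.sum_apply, Matrix.smul_apply, smul_eq_mul]
    rw [sum_mul_sum_right (fun i j => cg r r s i j k) (fun i j => (D i * D j) x y),
      sum_mul_sum_left (fun i j => cg r r s i j k) (fun i j => (D i * D j) x y)]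
    trans ∑ i, ∑ j, (∑ l, σ k l * cg r r s i j l) * (D i * D j) x y
    · simp only [Finset.mul_sum, Finset.sum_mul]
      rw [Finset.sum_comm]
      refine Finset.sum_congr rfl fun i _ => ?_
      rw [Finset.sum_comm]
      exact Finset.sum_congr rfl fun _ _ => Finset.sum_congr rfl fun _ _ => by ring
    · rw [← Finset.sum_add_distrib]
      refine Finset.sum_congr rfl fun i _ => ?_
      rw [← Finset.sum_add_distrib]
      refine Finset.sum_congr rfl fun j _ => ?_
      rw [← hc]
      ring
  rw [h2, h3]
  abel

/-- Because of that transposition the raising relation uses `cg_lower`, and the lowering relation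
`cg_raise`. -/
theorem IsTensorOp.couple {r : ℕ} (s : ℕ) {D : Fin (r + 1) → Matrix m.VirtIndex m.VirtIndex ℝ}
    (hD : m.IsTensorOp D) : m.IsTensorOp (couple s D) := fun k =>
  ⟨couple_commutator (ρ := fun i l => raising r i l) (σ := fun k l => raising s k l)
      (fun i => (hD i).1) (fun i j k => cg_lower r r s i j k) k,
    couple_commutator (ρ := fun i l => raising r l i) (σ := fun k l => raising s l k)
      (fun i => (hD i).2) (fun i j k => cg_raise r r s i j k) k⟩

/-- A tensor operator vanishes if it vanishes between the lowest states of all multiplets. -/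
theorem IsTensorOp.eq_zero {s : ℕ} {D : Fin (s + 1) → Matrix m.VirtIndex m.VirtIndex ℝ}
    (hD : m.IsTensorOp D) (h : ∀ k a c, D k ⟨a, 0⟩ ⟨c, 0⟩ = 0) (k : Fin (s + 1)) : D k = 0 := by
  -- Climb the row multiplet with the column kept lowest: the lowering relation has no term on the
  -- right there, and the other components vanish by induction, which is why all k are treated at
  -- once.
  have h1 : ∀ a c (p : Fin (m.virt a + 1)) k, D k ⟨a, p⟩ ⟨c, 0⟩ = 0 := by
    intro a c p
    induction p using Fin.induction with
    | zero => exact fun k => h k a c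
    | succ p ih =>
      intro k
      have e := congrFun (congrFun (hD k).2 ⟨a, p.castSucc⟩) ⟨c, 0⟩
      rw [Matrix.add_apply, virtRaising_transpose_mul_apply, mul_virtRaising_transpose_apply,
        Matrix.sum_apply] at e
      simp only [Matrix.smul_apply, ih, smul_zero, Finset.sum_const_zero, add_zero] at e
      rw [sum_raising_apply_zero, sum_raising_castSucc] at e
      have hp := p.is_lt
      exact (mul_eq_zero.mp e).resolve_left (ladder_pos (by omega) (by omega)).ne'
  -- Then climb the column multiplet with the raising relation, whose left side vanishes by
  -- induction.
  have h2 : ∀ a c (q : Fin (m.virt c + 1)) (p : Fin (m.virt a + 1)) k,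
      D k ⟨a, p⟩ ⟨c, q⟩ = 0 := by
    intro a c q
    induction q using Fin.induction with
    | zero => exact h1 a c
    | succ q ih =>
      intro p k
      have e := congrFun (congrFun (hD k).1 ⟨a, p⟩) ⟨c, q.castSucc⟩
      rw [Matrix.add_apply, virtRaising_mul_apply, mul_virtRaising_apply, Matrix.sum_apply] at e
      simp only [Matrix.smul_apply, ih, smul_zero, mul_zero, Finset.sum_const_zero, add_zero] at e
      rw [sum_raising_castSucc] at e
      have hq := q.is_lt
      exact (mul_eq_zero.mp e.symm).resolve_left (ladder_pos (by omega) (by omega)).ne'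
  ext ⟨a, p⟩ ⟨c, q⟩
  exact h2 a c q p k

/-- A spin-0 tensor operator commutes with the ladder operators, as the identity does, so
`IsTensorOp.eq_zero` applies to the difference. -/
theorem IsTensorOp.eq_smul_one {D : Fin (0 + 1) → Matrix m.VirtIndex m.VirtIndex ℝ}
    (hD : m.IsTensorOp D) (t : ℝ)
    (h : ∀ a c, D 0 ⟨a, 0⟩ ⟨c, 0⟩ = if a = c then t else 0) : D 0 = t • 1 := by
  have hz : ∀ k l : Fin (0 + 1), raising 0 k l = 0 := fun k l => by
    rw [raising, Matrix.of_apply, if_neg (by omega)]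
  have hE : m.IsTensorOp (fun k => D k - t • (1 : Matrix m.VirtIndex m.VirtIndex ℝ)) := by
    intro k
    have h1 := (hD k).1
    have h2 := (hD k).2
    simp only [hz, zero_smul, Finset.sum_const_zero, add_zero] at h1 h2 ⊢
    simp only [Matrix.mul_sub, Matrix.sub_mul, h1, h2, Matrix.mul_smul, Matrix.smul_mul,
      Matrix.mul_one, Matrix.one_mul, and_self]
  refine sub_eq_zero.mp (hE.eq_zero (fun k a c => ?_) 0)
  rw [show k = 0 from Fin.ext (by omega), Matrix.sub_apply, h, Matrix.smul_apply, Matrix.one_apply]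
  by_cases hac : a = c
  · subst hac; simp
  · have : (⟨a, 0⟩ : m.VirtIndex) ≠ ⟨c, 0⟩ := fun hh => hac (congrArg Sigma.fst hh)
    simp [hac, this]

theorem realKraus_mul_apply (M₁ M₂ : Fin (2 * m.S + 1)) (a c : Fin m.n)
    (ka : Fin (m.virt a + 1)) (kc : Fin (m.virt c + 1)) :
    (m.realKraus M₁ * m.realKraus M₂) ⟨a, ka⟩ ⟨c, kc⟩ =
      ∑ b, m.T a b * coupledLeft (m.virt a) (2 * m.S) (m.virt b) (m.virt c) kc (ka, M₁, M₂) *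
        m.T b c := by
  rw [Matrix.mul_apply, Fintype.sum_sigma]
  refine Finset.sum_congr rfl fun b _ => ?_
  simp only [realKraus, coupledLeft, Matrix.of_apply, Finset.mul_sum, Finset.sum_mul]
  exact Finset.sum_congr rfl fun _ _ => by ring

/-- The left-coupled states in the F-symbol, weighted by `T`, are the entries of a product of two
Kraus operators; summing over the two physical indices in the right-coupled states first produces
`couple`. -/
theorem R_eq_sum_couple (ST : ℕ) (a c : Fin m.n) (kc : Fin (m.virt c + 1)) :
    m.R ST a c kc = ∑ ka, ∑ kT, cg (m.virt a) (2 * ST) (m.virt c) ka kT kc *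
      couple (2 * ST) m.realKraus kT ⟨a, ka⟩ ⟨c, kc⟩ := by
  have h1 : m.R ST a c kc = ∑ x : Fin (m.virt a + 1) × Fin (2 * m.S + 1) × Fin (2 * m.S + 1),
      (m.realKraus x.2.1 * m.realKraus x.2.2) ⟨a, x.1⟩ ⟨c, kc⟩ *
        coupledRight (m.virt a) (2 * m.S) (2 * ST) (m.virt c) kc x := by
    simp only [R, fSymbol, realKraus_mul_apply, Finset.mul_sum, Finset.sum_mul]
    rw [Finset.sum_comm]
    exact Finset.sum_congr rfl fun _ _ => Finset.sum_congr rfl fun _ _ => by ring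
  rw [h1, Fintype.sum_prod_type]
  refine Finset.sum_congr rfl fun ka _ => ?_
  simp only [couple, coupledRight, Matrix.sum_apply, Matrix.smul_apply, smul_eq_mul,
    Finset.mul_sum]
  rw [Fintype.sum_prod_type, Finset.sum_comm (s := Finset.univ (α := Fin (2 * ST + 1)))]
  refine Finset.sum_congr rfl fun i _ => ?_
  rw [Finset.sum_comm (s := Finset.univ (α := Fin (2 * ST + 1)))]
  exact Finset.sum_congr rfl fun _ _ => Finset.sum_congr rfl fun _ _ => by ring

theorem renormalizationCondition_of_couple
    (h : ∀ ST ∈ m.K, ∀ k, couple (2 * ST) m.realKraus k = 0) : m.RenormalizationCondition := by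
  intro ST hST a c kc
  rw [R_eq_sum_couple]
  simp [h ST hST]

theorem weightIsometry_of_norm (hinj : Function.Injective m.virt)
    (hnorm : ∀ b, ∑ a, m.T a b ^ 2 = 1) : m.WeightIsometry := by
  intro b b' h
  obtain rfl := hinj h
  simpa [sq] using hnorm b

/-- The block (b, b') is a combination of Gram matrices weighted by `T a b * T a b'`. For b ≠ b' the
virtual spins differ and these are zero; for b = b' they are identities wherever `T` is nonzero. -/
theorem krausIsometry_of_norm (hinj : Function.Injective m.virt)
    (htri : ∀ a b, m.T a b ≠ 0 → Triangle (m.virt a) (2 * m.S) (m.virt b))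
    (hnorm : ∀ b, ∑ a, m.T a b ^ 2 = 1) : m.KrausIsometry := by
  have key : ∑ M, (m.realKraus M)ᵀ * m.realKraus M = 1 := by
    ext ⟨b, kb⟩ ⟨b', kb'⟩
    have h1 : (∑ M, (m.realKraus M)ᵀ * m.realKraus M) ⟨b, kb⟩ ⟨b', kb'⟩ =
        ∑ a, m.T a b * m.T a b' * ((cgMatrix (m.virt a) (2 * m.S) (m.virt b))ᵀ *
          cgMatrix (m.virt a) (2 * m.S) (m.virt b')) kb kb' := by
      simp only [cgMatrix_gram_apply]
      simp only [Matrix.sum_apply, Matrix.mul_apply, Fintype.sum_sigma,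
        Matrix.transpose_apply, realKraus, Matrix.of_apply, Finset.mul_sum]
      rw [Finset.sum_comm]
      refine Finset.sum_congr rfl fun a _ => ?_
      rw [Finset.sum_comm]
      exact Finset.sum_congr rfl fun _ _ => Finset.sum_congr rfl fun _ _ => by ring
    rw [h1, Matrix.one_apply]
    by_cases hb : b = b'
    · subst hb
      have h2 : ∀ a, m.T a b * m.T a b * ((cgMatrix (m.virt a) (2 * m.S) (m.virt b))ᵀ *
          cgMatrix (m.virt a) (2 * m.S) (m.virt b)) kb kb' =
          m.T a b ^ 2 * (1 : Matrix (Fin (m.virt b + 1)) (Fin (m.virt b + 1)) ℝ) kb kb' := by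
        intro a
        by_cases hT : m.T a b = 0
        · rw [hT]; ring
        · rw [cgMatrix_gram_self (htri a b hT)]; ring
      simp only [h2, ← Finset.sum_mul, hnorm, one_mul, Matrix.one_apply]
      simp
    · rw [if_neg (fun h => hb (congrArg Sigma.fst h))]
      refine Finset.sum_eq_zero fun a _ => ?_
      rw [cgMatrix_gram_of_ne _ _ (fun h => hb (hinj h)), Matrix.zero_apply, mul_zero]
  have h := congrArg (fun X => X.map (algebraMap ℝ ℂ)) key
  unfold KrausIsometry
  rw [Matrix.map_one _ (map_zero _) (map_one _)] at h
  rw [← h]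
  ext x y
  simp only [Matrix.sum_apply, Matrix.map_apply, map_sum, Matrix.mul_apply, kraus_eq_map,
    Matrix.conjTranspose_apply, Matrix.transpose_apply, map_mul]
  simp

end Model

end

end SpinChain

/-! ### Projectors on the chain, the Hamiltonian, and the matrix product state. -/

namespace SpinChain

open scoped Matrix

noncomputable section

theorem spinPlus_eq_map (J : ℕ) : spinPlus J = (raising J).map (algebraMap ℝ ℂ) := by
  ext k l
  simp only [spinPlus, raising, Matrix.of_apply, Matrix.map_apply, ladder]
  split_ifs with h
  · rw [h]
    push_cast
    rw [show (J : ℝ) - (l + 1) + 1 = J - l by ring]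
    rfl
  · simp

theorem spinPlus_conjTranspose (J : ℕ) :
    (spinPlus J)ᴴ = (raising J)ᵀ.map (algebraMap ℝ ℂ) := by
  rw [spinPlus_eq_map]
  ext k l
  simp

theorem isHermitian_spin (J : ℕ) (a : Fin 3) : (spin J a).IsHermitian := by
  fin_cases a
  · ext k l
    simp [spin, add_comm]
  · ext k l
    simp [spin]
    ring
  · ext k l
    by_cases h : k = l
    · subst h; simp [spin, spinZ]
    · simp [spin, spinZ, h, Ne.symm h]

section Chain

variable {N d : ℕ}

theorem siteOp_add (i : Fin N) (X Y : Matrix (Fin d) (Fin d) ℂ) :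
    siteOp i (X + Y) = siteOp i X + siteOp i Y := by
  ext σ τ
  simp only [siteOp, Matrix.of_apply, Matrix.add_apply]
  split_ifs <;> simp

theorem siteOp_smul (i : Fin N) (t : ℂ) (X : Matrix (Fin d) (Fin d) ℂ) :
    siteOp i (t • X) = t • siteOp i X := by
  ext σ τ
  simp only [siteOp, Matrix.of_apply, Matrix.smul_apply]
  split_ifs <;> simp

theorem siteOp_sub (i : Fin N) (X Y : Matrix (Fin d) (Fin d) ℂ) :
    siteOp i (X - Y) = siteOp i X - siteOp i Y := by
  ext σ τ
  simp only [siteOp, Matrix.of_apply, Matrix.sub_apply]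
  split_ifs <;> simp

theorem isHermitian_siteOp (i : Fin N) {X : Matrix (Fin d) (Fin d) ℂ} (hX : X.IsHermitian) :
    (siteOp i X).IsHermitian := by
  ext σ τ
  simp only [siteOp, Matrix.of_apply, Matrix.conjTranspose_apply]
  have hiff : (∀ k, k ≠ i → τ k = σ k) ↔ ∀ k, k ≠ i → σ k = τ k :=
    forall_congr' fun k => imp_congr_right fun _ => eq_comm
  by_cases h : ∀ k, k ≠ i → σ k = τ k
  · rw [if_pos h, if_pos (hiff.mpr h)]
    exact hX.apply _ _
  · rw [if_neg h, if_neg (fun h' => h (hiff.mp h')), star_zero]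

theorem siteOp_mulVec (i : Fin N) (X : Matrix (Fin d) (Fin d) ℂ) (f : (Fin N → Fin d) → ℂ)
    (σ : Fin N → Fin d) :
    (siteOp i X *ᵥ f) σ = ∑ x, X (σ i) x * f (Function.update σ i x) := by
  rw [Matrix.mulVec, dotProduct]
  symm
  refine Finset.sum_of_injOn (fun x => Function.update σ i x) ?_ (by simp) ?_ ?_
  · intro x _ y _ h
    simpa using congrFun h i
  · intro τ _ hτ
    rw [siteOp, Matrix.of_apply, if_neg, zero_mul]
    intro h
    refine hτ ⟨τ i, by simp, ?_⟩
    ext k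
    by_cases hk : k = i
    · subst hk; simp
    · simp [hk, h k hk]
  · intro x _
    rw [siteOp, Matrix.of_apply, if_pos]
    · simp
    · intro k hk
      simp [hk]

theorem isHermitian_totalSpinSq (S : ℕ) (i j : Fin N) : (totalSpinSq S i j).IsHermitian := by
  unfold totalSpinSq
  rw [Matrix.IsHermitian, Matrix.conjTranspose_sum]
  refine Finset.sum_congr rfl fun a _ => ?_
  have h : (siteOp i (spin (2 * S) a) + siteOp j (spin (2 * S) a)).IsHermitian :=
    (isHermitian_siteOp i (isHermitian_spin _ a)).add (isHermitian_siteOp j (isHermitian_spin _ a))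
  exact (h.pow 2)

/-- S² = ½(S⁺S⁻ + S⁻S⁺) + (Sᶻ)², which reduces the total spin to the ladder relations. -/
theorem totalSpinSq_eq (S : ℕ) (i j : Fin N) :
    totalSpinSq S i j =
      (1 / 2 : ℂ) • ((siteOp i (spinPlus (2 * S)) + siteOp j (spinPlus (2 * S))) *
          (siteOp i (spinPlus (2 * S))ᴴ + siteOp j (spinPlus (2 * S))ᴴ) +
        (siteOp i (spinPlus (2 * S))ᴴ + siteOp j (spinPlus (2 * S))ᴴ) *
          (siteOp i (spinPlus (2 * S)) + siteOp j (spinPlus (2 * S)))) +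
      (siteOp i (spinZ (2 * S)) + siteOp j (spinZ (2 * S))) ^ 2 := by
  unfold totalSpinSq
  rw [Fin.sum_univ_three]
  congr 1
  simp only [spin, Matrix.cons_val_zero, Matrix.cons_val_one, siteOp_smul, siteOp_add, siteOp_sub,
    ← smul_add]
  set p := siteOp i (spinPlus (2 * S))
  set p' := siteOp j (spinPlus (2 * S))
  set q := siteOp i (spinPlus (2 * S))ᴴ
  set q' := siteOp j (spinPlus (2 * S))ᴴ
  rw [show p + q + (p' + q') = (p + p') + (q + q') by abel,
    show p - q + (p' - q') = (p + p') - (q + q') by abel]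
  set x := p + p'
  set y := q + q'
  have hI : (1 / (2 * Complex.I)) * (1 / (2 * Complex.I)) = -(1 / 4 : ℂ) := by
    have hI0 := Complex.I_ne_zero
    field_simp
    rw [Complex.I_sq]
    norm_num
  rw [sq, sq, Matrix.smul_mul, Matrix.mul_smul, smul_smul, Matrix.smul_mul, Matrix.mul_smul,
    smul_smul, hI]
  have e : (x + y) * (x + y) - (x - y) * (x - y) = (2 : ℂ) • (x * y + y * x) := by
    rw [two_smul]; noncomm_ring
  rw [show (1 / 2 * (1 / 2) : ℂ) = 1 / 4 by norm_num, neg_smul, ← sub_eq_add_neg, ← smul_sub, e,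
    smul_smul]
  norm_num

/-- The states in which two sites are coupled to spin `s / 2`. -/
def coupledState (r s : ℕ) (i j : Fin N) (g : (Fin N → Fin (r + 1)) → ℂ) (k : Fin (s + 1)) :
    (Fin N → Fin (r + 1)) → ℂ :=
  fun σ => (cg r r s (σ i) (σ j) k : ℂ) * g σ

variable {r s : ℕ} {i j : Fin N} {g : (Fin N → Fin (r + 1)) → ℂ}

/-- Since `g` does not depend on the sites i and j, the operators act on the Clebsch–Gordan factor
only. -/
theorem siteOp_coupledState (hij : i ≠ j) (hi : ∀ σ x, g (Function.update σ i x) = g σ)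
    (hj : ∀ σ x, g (Function.update σ j x) = g σ) {X : Matrix (Fin (r + 1)) (Fin (r + 1)) ℝ}
    {Y : Matrix (Fin (s + 1)) (Fin (s + 1)) ℝ}
    (h : ∀ k₁ k₂ k, ∑ l, X k₁ l * cg r r s l k₂ k + ∑ l, X k₂ l * cg r r s k₁ l k =
      ∑ l, Y l k * cg r r s k₁ k₂ l) (k : Fin (s + 1)) :
    (siteOp i (X.map (algebraMap ℝ ℂ)) + siteOp j (X.map (algebraMap ℝ ℂ))) *ᵥ
      coupledState r s i j g k = ∑ l, (Y l k : ℂ) • coupledState r s i j g l := by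
  ext σ
  rw [Matrix.add_mulVec, Pi.add_apply, siteOp_mulVec, siteOp_mulVec, Finset.sum_apply]
  simp only [coupledState, hi, hj, Function.update_self, Function.update_of_ne hij,
    Function.update_of_ne hij.symm, Matrix.map_apply, Pi.smul_apply, smul_eq_mul, ← mul_assoc,
    ← Finset.sum_mul, ← add_mul]
  congr 1
  have := congrArg (algebraMap ℝ ℂ) (h (σ i) (σ j) k)
  simpa using this

theorem raising_transpose_mul (J : ℕ) :
    (raising J)ᵀ * raising J =
      Matrix.diagonal fun k : Fin (J + 1) => ((J - (k : ℕ) : ℤ) : ℝ) * ((k : ℕ) + 1 : ℤ) := by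
  ext k l
  rw [Matrix.mul_apply]
  have e : ∀ x, (raising J)ᵀ k x * raising J x l = raising J x k * raising J x l := fun _ => rfl
  simp only [e]
  rw [Matrix.diagonal_apply]
  split_ifs with h
  · subst h
    have hle := k.is_le
    rw [show ((J : ℤ) - (k : ℕ)) = J - ((k : ℕ) + 1) + 1 by ring,
      ← ladder_mul_self (by omega) (by omega)]
    induction k using Fin.lastCases with
    | last =>
      rw [Fin.val_last, ladder_top, mul_zero]
      refine Finset.sum_eq_zero fun x _ => ?_
      rw [raising, Matrix.of_apply, if_neg (by rw [Fin.val_last]; omega), zero_mul]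
    | cast k =>
      rw [sum_raising_castSucc, raising, Matrix.of_apply, if_pos (by simp)]
      simp
  · refine Finset.sum_eq_zero fun x _ => ?_
    simp only [raising, Matrix.of_apply]
    split_ifs with h1 h2 <;> try simp
    exact absurd (Fin.ext (by omega)) h

theorem sum_smul_sum_smul {ι V : Type*} [Fintype ι] [AddCommMonoid V] [Module ℂ V]
    (X Y : Matrix ι ι ℝ) (v : ι → V) (k : ι) :
    ∑ l, (Y l k : ℂ) • ∑ l', (X l' l : ℂ) • v l' = ∑ l', (((X * Y) l' k : ℝ) : ℂ) • v l' := by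
  simp only [Finset.smul_sum, smul_smul]
  rw [Finset.sum_comm]
  refine Finset.sum_congr rfl fun l' _ => ?_
  rw [← Finset.sum_smul, Matrix.mul_apply]
  push_cast
  congr 1
  exact Finset.sum_congr rfl fun _ _ => mul_comm _ _

theorem sum_diagonal_smul {ι V : Type*} [Fintype ι] [DecidableEq ι] [AddCommMonoid V] [Module ℂ V]
    (w : ι → ℝ) (v : ι → V) (k : ι) :
    ∑ l, (((Matrix.diagonal w) l k : ℝ) : ℂ) • v l = (w k : ℂ) • v k := by
  rw [Finset.sum_eq_single k]
  · simp
  · intro l _ hl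
    simp [Matrix.diagonal_apply_ne _ hl]
  · simp

end Chain

section Chain

variable {N S s : ℕ} {i j : Fin N} {g : (Fin N → Fin (2 * S + 1)) → ℂ}

theorem spinZ_coupledState (hij : i ≠ j) (hi : ∀ σ x, g (Function.update σ i x) = g σ)
    (hj : ∀ σ x, g (Function.update σ j x) = g σ) (k : Fin (2 * s + 1)) :
    (siteOp i (spinZ (2 * S)) + siteOp j (spinZ (2 * S))) *ᵥ coupledState (2 * S) (2 * s) i j g k =
      ((k : ℂ) - s) • coupledState (2 * S) (2 * s) i j g k := by
  ext σ
  rw [Matrix.add_mulVec, Pi.add_apply, siteOp_mulVec, siteOp_mulVec]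
  simp only [coupledState, hi, hj, Function.update_self, Function.update_of_ne hij,
    Function.update_of_ne hij.symm, spinZ, Matrix.diagonal_apply, ite_mul, zero_mul,
    Finset.sum_ite_eq, Finset.mem_univ, if_true, Pi.smul_apply, smul_eq_mul]
  by_cases h : (2 * (σ i : ℤ) - (2 * S : ℕ)) + (2 * (σ j : ℤ) - (2 * S : ℕ)) =
      2 * (k : ℤ) - (2 * s : ℕ)
  · have h' : (σ i : ℤ) + σ j = k - s + 2 * S := by push_cast at h; omega
    have h'' : ((σ i : ℕ) : ℂ) + (σ j : ℕ) = (k : ℕ) - s + 2 * S := by exact_mod_cast h'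
    push_cast
    linear_combination (cg (2 * S) (2 * S) (2 * s) (σ i) (σ j) k : ℂ) * g σ * h''
  · rw [cg_eq_zero_of_weight h]; simp

/-- The coupled states are eigenvectors of the total spin of the two sites. -/
theorem totalSpinSq_coupledState (hij : i ≠ j) (hi : ∀ σ x, g (Function.update σ i x) = g σ)
    (hj : ∀ σ x, g (Function.update σ j x) = g σ) (k : Fin (2 * s + 1)) :
    totalSpinSq S i j *ᵥ coupledState (2 * S) (2 * s) i j g k =
      ((s : ℂ) * (s + 1)) • coupledState (2 * S) (2 * s) i j g k := by
  have hP := siteOp_coupledState (s := 2 * s) hij hi hj (cg_raise (2 * S) (2 * S) (2 * s))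
  have hQ := siteOp_coupledState (s := 2 * s) (X := (raising (2 * S))ᵀ)
    (Y := (raising (2 * s))ᵀ) hij hi hj (cg_lower (2 * S) (2 * S) (2 * s))
  have hZ := spinZ_coupledState (s := s) hij hi hj
  rw [← spinPlus_eq_map] at hP
  rw [← spinPlus_conjTranspose] at hQ
  rw [totalSpinSq_eq, Matrix.add_mulVec, Matrix.smul_mulVec, Matrix.add_mulVec,
    ← Matrix.mulVec_mulVec, ← Matrix.mulVec_mulVec, sq, ← Matrix.mulVec_mulVec, hZ,
    Matrix.mulVec_smul, hZ, hP, hQ, Matrix.mulVec_sum, Matrix.mulVec_sum]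
  simp only [Matrix.mulVec_smul, hP, hQ]
  rw [sum_smul_sum_smul, sum_smul_sum_smul, raising_mul_transpose, raising_transpose_mul,
    sum_diagonal_smul, sum_diagonal_smul, ← add_smul, smul_smul, smul_smul, ← add_smul]
  -- The eigenvalue: ½((2s - k + 1)k + (2s - k)(k + 1)) + (k - s)² = s(s + 1).
  congr 1
  push_cast
  ring

/-- Eigenspaces of a Hermitian operator for distinct eigenvalues are orthogonal, and s ↦ s(s + 1) is
injective on the naturals. -/
theorem proj_coupledState {ST : ℕ} (hST : ST ≠ s) (hij : i ≠ j)
    (hi : ∀ σ x, g (Function.update σ i x) = g σ)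
    (hj : ∀ σ x, g (Function.update σ j x) = g σ) (k : Fin (2 * s + 1)) :
    proj S ST i j (WithLp.toLp 2 (coupledState (2 * S) (2 * s) i j g k)) = 0 := by
  unfold proj
  rw [Submodule.starProjection_apply_eq_zero_iff, Submodule.mem_orthogonal]
  intro v hv
  have hsym := Matrix.isSymmetric_toEuclideanLin_iff.mpr (isHermitian_totalSpinSq S i j)
  have hne : (ST : ℂ) * (ST + 1) ≠ (s : ℂ) * (s + 1) := by
    intro h
    have h' : ST * (ST + 1) = s * (s + 1) := by exact_mod_cast h
    rcases lt_or_gt_of_ne hST with h1 | h1 <;> nlinarith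
  have hw : WithLp.toLp 2 (coupledState (2 * S) (2 * s) i j g k) ∈
      Module.End.eigenspace (Matrix.toEuclideanLin (totalSpinSq S i j)) ((s : ℂ) * (s + 1)) := by
    rw [Module.End.mem_eigenspace_iff, Matrix.toLpLin_toLp, Matrix.toLin'_apply,
      totalSpinSq_coupledState hij hi hj]
    rfl
  exact hsym.orthogonalFamily_eigenspaces hne ⟨v, hv⟩ ⟨_, hw⟩

end Chain

theorem trace_prod_ofFn_add_one {ι : Type*} [Fintype ι] [DecidableEq ι] {n : ℕ}
    (f : Fin (n + 1) → Matrix ι ι ℝ) :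
    (List.ofFn fun k => f (k + 1)).prod.trace = (List.ofFn f).prod.trace := by
  rw [List.ofFn_succ', List.ofFn_succ, List.concat_eq_append, List.prod_append, List.prod_cons,
    List.prod_cons, List.prod_nil, mul_one, Matrix.trace_mul_comm, Fin.last_add_one]
  congr 4
  ext k : 1
  rw [Fin.coeSucc_eq_succ]

theorem trace_prod_ofFn_add {ι : Type*} [Fintype ι] [DecidableEq ι] {n : ℕ}
    (f : Fin (n + 1) → Matrix ι ι ℝ) (i : Fin (n + 1)) :
    (List.ofFn fun k => f (k + i)).prod.trace = (List.ofFn f).prod.trace := by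
  induction i using Fin.induction with
  | zero => simp
  | succ i ih =>
    rw [← ih, ← trace_prod_ofFn_add_one fun k => f (k + i.castSucc)]
    simp only [← Fin.coeSucc_eq_succ, add_assoc, add_comm (1 : Fin (n + 1))]

/-- The trace of a product along a ring, with two neighbouring factors singled out. -/
theorem exists_trace_prod_ofFn_eq {ι : Type*} [Fintype ι] [DecidableEq ι] {N d : ℕ} (hN : 2 ≤ N)
    (A : Fin d → Matrix ι ι ℝ) (i : Fin N) :
    i ≠ finRotate N i ∧ ∃ B : (Fin N → Fin d) → Matrix ι ι ℝ,
      (∀ σ x, B (Function.update σ i x) = B σ) ∧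
      (∀ σ x, B (Function.update σ (finRotate N i) x) = B σ) ∧
      ∀ σ, (List.ofFn fun k => A (σ k)).prod.trace =
        (A (σ i) * A (σ (finRotate N i)) * B σ).trace := by
  obtain ⟨n, rfl⟩ := Nat.exists_eq_add_of_le' hN
  rw [finRotate_apply]
  have hne : ∀ k : Fin n, k.succ.succ + i ≠ i ∧ k.succ.succ + i ≠ i + 1 := by
    intro k
    constructor
    · intro h
      have := add_eq_right.mp h
      exact absurd this (Fin.succ_ne_zero _)
    · intro h
      rw [add_comm i] at h
      have := add_right_cancel h
      rw [← Fin.succ_zero_eq_one] at this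
      exact absurd (Fin.succ_injective _ this) (Fin.succ_ne_zero _)
  -- `B` is the product over the other N - 2 sites, starting at i + 2 after rotating the ring so
  -- that i comes first.
  refine ⟨fun h => ?_, fun σ => (List.ofFn fun k : Fin n => A (σ (k.succ.succ + i))).prod,
    fun σ x => ?_, fun σ x => ?_, fun σ => ?_⟩
  · have := left_eq_add.mp h
    exact absurd this (by simp)
  · simp only [Function.update_of_ne (hne _).1]
  · simp only [Function.update_of_ne (hne _).2]
  · rw [← trace_prod_ofFn_add _ i, List.ofFn_succ, List.ofFn_succ, List.prod_cons, List.prod_cons,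
      Matrix.mul_assoc, zero_add, Fin.succ_zero_eq_one, add_comm 1 i]

namespace Model

variable {m : Model}

theorem mps_apply (N : ℕ) (σ : Fin N → Fin (2 * m.S + 1)) :
    m.mps N σ = (((List.ofFn fun k => m.realKraus (σ k)).prod.trace : ℝ) : ℂ) := by
  have h : ∀ l : List (Matrix m.VirtIndex m.VirtIndex ℝ),
      (l.map fun X => X.map (algebraMap ℝ ℂ)).prod = l.prod.map (algebraMap ℝ ℂ) := by
    intro l
    induction l with
    | nil => simp
    | cons X l ih => rw [List.map_cons, List.prod_cons, List.prod_cons, ih, Matrix.map_mul]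
  have h2 : (List.ofFn fun i => m.kraus (σ i)) =
      (List.ofFn fun k => m.realKraus (σ k)).map fun X => X.map (algebraMap ℝ ℂ) := by
    rw [List.map_ofFn]
    rfl
  change ((List.ofFn fun i => m.kraus (σ i)).prod).trace = _
  rw [h2, h]
  exact (AddMonoidHom.map_trace (algebraMap ℝ ℂ).toAddMonoidHom _).symm

theorem mul_eq_sum_couple {D : Fin (2 * m.S + 1) → Matrix m.VirtIndex m.VirtIndex ℝ}
    (x y : Fin (2 * m.S + 1)) :
    D x * D y = ∑ s : Fin (2 * m.S + 1), ∑ k : Fin (2 * (s : ℕ) + 1),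
      cg (2 * m.S) (2 * m.S) (2 * s) x y k • couple (2 * s) D k := by
  have h : D x * D y = ∑ p : Fin (2 * m.S + 1) × Fin (2 * m.S + 1),
      (if (x, y) = p then (1 : ℝ) else 0) • (D p.1 * D p.2) := by
    simp
  rw [h]
  simp only [← sum_cg_mul_cg, couple, Finset.smul_sum, Finset.sum_smul, smul_smul]
  rw [Finset.sum_comm]
  refine Finset.sum_congr rfl fun s _ => ?_
  rw [Finset.sum_comm]
  refine Finset.sum_congr rfl fun k _ => ?_
  rw [Fintype.sum_prod_type]

/-- The projections on the total spins that do not occur in a pair of Kraus operators annihilate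
the matrix product state. -/
theorem proj_mps {ST : ℕ} (h : ∀ k, couple (2 * ST) m.realKraus k = 0) {N : ℕ} (hN : 2 ≤ N)
    (i : Fin N) : proj m.S ST i (finRotate N i) (m.mps N) = 0 := by
  obtain ⟨hij, B, hB, hB', hσ⟩ := exists_trace_prod_ofFn_eq hN m.realKraus i
  -- Completeness at the bond (i, i+1): the coefficient of each coupled state involves only the
  -- remaining sites.
  have hmps : m.mps N = ∑ s : Fin (2 * m.S + 1), ∑ k : Fin (2 * (s : ℕ) + 1),
      WithLp.toLp 2 (coupledState (2 * m.S) (2 * s) i (finRotate N i)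
        (fun σ => (((couple (2 * s) m.realKraus k * B σ).trace : ℝ) : ℂ)) k) := by
    ext σ
    rw [mps_apply, hσ, mul_eq_sum_couple]
    simp only [Matrix.sum_mul, Matrix.trace_sum, Matrix.smul_mul, Matrix.trace_smul,
      Complex.ofReal_sum, smul_eq_mul, Complex.ofReal_mul, WithLp.ofLp_sum, Finset.sum_apply,
      coupledState]
  rw [hmps, map_sum]
  refine Finset.sum_eq_zero fun s _ => ?_
  rw [map_sum]
  refine Finset.sum_eq_zero fun k _ => ?_
  by_cases hs : ST = s
  · subst hs
    simp only [h, Matrix.zero_mul, Matrix.trace_zero, Complex.ofReal_zero]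
    have hz : WithLp.toLp 2 (coupledState (2 * m.S) (2 * s) i (finRotate N i) (fun _ => 0) k) = 0 := by
      ext σ
      simp [coupledState]
    rw [hz, map_zero]
  · exact proj_coupledState hs hij (fun σ x => by rw [hB]) (fun σ x => by rw [hB']) k

theorem hamiltonian_isPositive {J : ℕ → ℝ} (hJ : ∀ ST ∈ m.K, 0 < J ST) (N : ℕ) :
    (m.hamiltonian J N).IsPositive := by
  unfold hamiltonian
  refine ContinuousLinearMap.isPositive_sum _ fun i _ =>
    ContinuousLinearMap.isPositive_sum _ fun ST hST => ?_
  refine ContinuousLinearMap.IsPositive.smul_of_nonneg ?_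
    (by exact_mod_cast (hJ ST hST).le)
  exact ContinuousLinearMap.IsPositive.of_isStarProjection isStarProjection_starProjection

theorem hamiltonian_mps (h : ∀ ST ∈ m.K, ∀ k, couple (2 * ST) m.realKraus k = 0) (J : ℕ → ℝ)
    {N : ℕ} (hN : 2 ≤ N) : m.hamiltonian J N (m.mps N) = 0 := by
  unfold hamiltonian
  rw [_root_.sum_apply]
  refine Finset.sum_eq_zero fun i _ => ?_
  rw [_root_.sum_apply]
  refine Finset.sum_eq_zero fun ST hST => ?_
  rw [_root_.smul_apply, proj_mps (h ST hST) hN, smul_zero]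

theorem trace_prod_map_eq_zero {N : ℕ} (h : m.mps N = 0) (l : List (Fin (2 * m.S + 1)))
    (hl : l.length = N) : (l.map m.realKraus).prod.trace = 0 := by
  subst hl
  have h1 := mps_apply (m := m) l.length l.get
  rw [h] at h1
  have h2 : (List.ofFn fun k => m.realKraus (l.get k)) = l.map m.realKraus := by
    conv_rhs => rw [← List.ofFn_get l, List.map_ofFn]
    rfl
  rw [h2] at h1
  exact Complex.ofReal_eq_zero.mp h1.symm

/-- Expanding one singlet factor writes the trace as a combination of traces with a word longer by
two letters and one factor fewer; with none left, the traces are the components of the state. -/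
theorem trace_prod_map_mul_couple_pow {N : ℕ} (h : m.mps N = 0) (n : ℕ) :
    ∀ l : List (Fin (2 * m.S + 1)), l.length + 2 * n = N →
      ((l.map m.realKraus).prod * couple 0 m.realKraus 0 ^ n).trace = 0 := by
  induction n with
  | zero =>
    intro l hl
    rw [pow_zero, mul_one]
    exact trace_prod_map_eq_zero h l hl
  | succ n ih =>
    intro l hl
    rw [pow_succ']
    generalize couple 0 m.realKraus 0 ^ n = X at ih ⊢
    rw [couple, Finset.sum_mul, Finset.mul_sum, Matrix.trace_sum]
    refine Finset.sum_eq_zero fun i _ => ?_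
    rw [Finset.sum_mul, Finset.mul_sum, Matrix.trace_sum]
    refine Finset.sum_eq_zero fun j _ => ?_
    have h1 := ih (l ++ [i, j]) (by rw [List.length_append]; simp; omega)
    rw [List.map_append, List.prod_append] at h1
    simp only [List.map_cons, List.map_nil, List.prod_cons, List.prod_nil, mul_one] at h1
    rw [smul_mul_assoc, mul_smul_comm, Matrix.trace_smul, ← mul_assoc, h1, smul_zero]

/-- If the singlet coupling of two Kraus operators is a nonzero scalar, the state does not vanish
as soon as the trace of some shorter word of the right parity does not. -/
theorem mps_ne_zero {t : ℝ} (ht : t ≠ 0) (h0 : couple 0 m.realKraus 0 = t • 1)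
    (l : List (Fin (2 * m.S + 1))) (hl : (l.map m.realKraus).prod.trace ≠ 0) {N n : ℕ}
    (hN : l.length + 2 * n = N) : m.mps N ≠ 0 := by
  intro h
  have h1 := trace_prod_map_mul_couple_pow h n l hN
  rw [h0, smul_pow, one_pow, mul_smul_comm, mul_one, Matrix.trace_smul] at h1
  exact hl ((smul_eq_zero.mp h1).resolve_left (pow_ne_zero n ht))

end Model

end

end SpinChain

/-! ### Reduction to integer identities. -/

namespace SpinChain

open scoped Matrix

/-- Binomial coefficients with an integral lower argument, in terms of factorials. -/
def intChoose (n : ℕ) (k : ℤ) : ℤ :=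
  if 0 ≤ k ∧ k ≤ n then
    ((n.factorial / (k.toNat.factorial * (n - k.toNat).factorial) : ℕ) : ℤ) else 0

/-- The alternating sum of Racah's formula, multiplied by `a! b! c!`. -/
def intRacah (J₁ J₂ J : ℕ) (k₁ k₂ : ℤ) : ℤ :=
  ∑ n ∈ Finset.range ((J₁ + J₂ - J) / 2 + 1), (-1) ^ n * (intChoose ((J₁ + J₂ - J) / 2) n *
    intChoose ((J₁ + J - J₂) / 2) (J₁ - k₁ - n) * intChoose ((J₂ + J - J₁) / 2) (k₂ - n))

/-- `(j + m)! (j - m)!`. -/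
def intFact (J : ℕ) (k : ℤ) : ℤ := ((k.toNat.factorial * (J - k).toNat.factorial : ℕ) : ℤ)

noncomputable section

/-- The normalization of a Clebsch-Gordan coefficient relative to `intRacah`. -/
def intNorm (J₁ J₂ J : ℕ) : ℝ :=
  √(((J : ℝ) + 1) / (((J₁ + J₂ - J) / 2).factorial * ((J₁ + J - J₂) / 2).factorial *
    ((J₂ + J - J₁) / 2).factorial * ((J₁ + J₂ + J) / 2 + 1).factorial))

theorem racahNorm_eq (J₁ J₂ J : ℕ) :
    racahNorm J₁ J₂ J = ((J₁ + J₂ - J) / 2).factorial * ((J₁ + J - J₂) / 2).factorial *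
      ((J₂ + J - J₁) / 2).factorial * intNorm J₁ J₂ J := by
  unfold racahNorm intNorm
  generalize (J₁ + J₂ - J) / 2 = a
  generalize (J₁ + J - J₂) / 2 = b
  generalize (J₂ + J - J₁) / 2 = c
  generalize ((J₁ + J₂ + J) / 2 + 1).factorial = d
  have h : (0 : ℝ) ≤ a.factorial * b.factorial * c.factorial := by positivity
  rw [← Real.sqrt_sq h, ← Real.sqrt_mul (by positivity), Real.sqrt_sq h]
  congr 1
  have ha : (a.factorial : ℝ) ≠ 0 := by positivity
  have hb : (b.factorial : ℝ) ≠ 0 := by positivity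
  have hc : (c.factorial : ℝ) ≠ 0 := by positivity
  by_cases hd : (d : ℝ) = 0
  · simp [hd]
  · field_simp

theorem intNorm_pos (J₁ J₂ J : ℕ) : 0 < intNorm J₁ J₂ J := by
  unfold intNorm
  positivity

theorem rootFact_pos (J : ℕ) (k : ℤ) : 0 < rootFact J k := by
  unfold rootFact
  positivity

theorem rootFact_mul_self (J : ℕ) (k : ℤ) : rootFact J k * rootFact J k = intFact J k := by
  unfold rootFact intFact
  rw [Real.mul_self_sqrt (by positivity)]
  push_cast
  rfl

theorem factorial_mul_invFact_mul_invFact {b : ℕ} {x y : ℤ} (h : x + y = b) :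
    (b.factorial : ℝ) * (invFact x * invFact y) = intChoose b x := by
  unfold intChoose
  split_ifs with hx
  · obtain ⟨p, rfl⟩ := Int.eq_ofNat_of_zero_le hx.1
    have hp : p ≤ b := by omega
    obtain rfl : y = (b - p : ℕ) := by omega
    rw [invFact_natCast, invFact_natCast, Int.toNat_natCast, ← Nat.choose_eq_factorial_div_factorial hp,
      Int.cast_natCast, Nat.cast_choose ℝ hp]
    field_simp
  · rcases not_and_or.mp hx with hx | hx
    · rw [invFact_of_neg (by omega)]; simp
    · rw [invFact_of_neg (z := y) (by omega)]; simp

/-- The six factorials in each Racah term pair up into three binomials: n with a - n, α - n with γ +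
n, β - n with δ + n, the arguments adding to a, b, c. -/
theorem factorial_mul_racahSum {J₁ J₂ J : ℕ} (h : Triangle J₁ J₂ J) (k₁ k₂ : ℤ) :
    (((J₁ + J₂ - J) / 2).factorial * ((J₁ + J - J₂) / 2).factorial *
      ((J₂ + J - J₁) / 2).factorial : ℝ) *
      racahSum ((J₁ + J₂ - J) / 2) (J₁ - k₁) k₂ (k₁ - ((J₁ + J₂ - J) / 2 : ℕ))
        (J₂ - k₂ - ((J₁ + J₂ - J) / 2 : ℕ)) = intRacah J₁ J₂ J k₁ k₂ := by
  unfold racahSum intRacah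
  obtain ⟨h1, h2, h3, r, hr⟩ := h
  have hb : (J₁ : ℤ) = ((J₁ + J₂ - J) / 2 : ℕ) + ((J₁ + J - J₂) / 2 : ℕ) := by omega
  have hc : (J₂ : ℤ) = ((J₁ + J₂ - J) / 2 : ℕ) + ((J₂ + J - J₁) / 2 : ℕ) := by omega
  generalize (J₁ + J₂ - J) / 2 = a at *
  generalize (J₁ + J - J₂) / 2 = b at *
  generalize (J₂ + J - J₁) / 2 = c at *
  rw [Finset.mul_sum]
  push_cast
  refine Finset.sum_congr rfl fun n _ => ?_
  unfold racahTerm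
  rw [← factorial_mul_invFact_mul_invFact (b := a) (x := n) (y := a - n) (by ring),
    ← factorial_mul_invFact_mul_invFact (b := b) (x := J₁ - k₁ - n) (y := k₁ - a + n) (by omega),
    ← factorial_mul_invFact_mul_invFact (b := c) (x := k₂ - n) (y := J₂ - k₂ - a + n) (by omega)]
  ring

theorem cgInt_eq_intRacah {J₁ J₂ J : ℕ} (h : Triangle J₁ J₂ J) {k₁ k₂ k : ℤ}
    (hk : k₁ + k₂ = k + ((J₁ + J₂ - J) / 2 : ℕ)) :
    cgInt J₁ J₂ J k₁ k₂ k = intNorm J₁ J₂ J * (rootFact J₁ k₁ * rootFact J₂ k₂ * rootFact J k) *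
      intRacah J₁ J₂ J k₁ k₂ := by
  rw [cgInt, if_pos ⟨h, hk⟩, racahNorm_eq, ← factorial_mul_racahSum h]
  ring

end

namespace Model

section Integral

variable (m : Model) (off : Fin m.n → ℕ) (w : Fin m.n → Fin m.n → ℤ)

/-- The matrix elements of the rescaled Kraus operators between weight spaces. The state `k` of
the multiplet `a` has the weight `k + off a`, and `A^M` raises the weight by `M - S`. -/
def entry (M : ℕ) (t : ℤ) (a b : Fin m.n) : ℤ :=
  if 0 ≤ t + M - m.S - off b ∧ t + M - m.S - off b ≤ m.virt b ∧ w a b ≠ 0 then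
    w a b * intRacah (m.virt a) (2 * m.S) (m.virt b) (t - off a) M *
      intFact (m.virt b) (t + M - m.S - off b) else 0

/-- The matrix elements of a product of rescaled Kraus operators. -/
def amplitude : List ℕ → ℤ → Fin m.n → Fin m.n → ℤ
  | [], _, a, c => if a = c then 1 else 0
  | M :: l, t, a, c => ∑ b, m.entry off w M t a b * amplitude l (t + M - m.S) b c

/-- The rescaled matrix element, between lowest states, of two Kraus operators coupled to the
spin `s`. -/
def intCouple (s : ℕ) (a c : Fin m.n) : ℤ :=
  ∑ i : Fin (2 * m.S + 1), ∑ j : Fin (2 * m.S + 1), if off a + i + j = off c + 2 * m.S then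
    intRacah (2 * m.S) (2 * m.S) (2 * s) (i : ℕ) (j : ℕ) * intFact (2 * m.S) (i : ℕ) *
      intFact (2 * m.S) (j : ℕ) * m.amplitude off w [i, j] (off a) a c else 0

/-- The rescaled trace of a product of Kraus operators. -/
def intTrace (l : List ℕ) : ℤ :=
  ∑ a, ∑ k : Fin (m.virt a + 1), m.amplitude off w l (k + off a) a a

end Integral

noncomputable section

variable {m : Model} {off : Fin m.n → ℕ} {w : Fin m.n → Fin m.n → ℤ}

/-- The rescaled Kraus operators. -/
def intKraus (m : Model) (off : Fin m.n → ℕ) (w : Fin m.n → Fin m.n → ℤ) (M : ℕ) :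
    Matrix m.VirtIndex m.VirtIndex ℤ :=
  Matrix.of fun x y => if (x.2 : ℤ) + off x.1 + M - m.S = y.2 + off y.1 then
    m.entry off w M (x.2 + off x.1) x.1 y.1 else 0

/-- A multiplet contains at most one state of a given weight, so the sum over intermediate states
collapses to the sum over multiplets in `amplitude`. -/
theorem prod_intKraus_apply (l : List ℕ) (x y : m.VirtIndex) :
    (l.map (m.intKraus off w)).prod x y =
      if (x.2 : ℤ) + off x.1 + (l.map fun M : ℕ => (M : ℤ) - m.S).sum = y.2 + off y.1 then
        m.amplitude off w l (x.2 + off x.1) x.1 y.1 else 0 := by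
  have hsum : ∀ (p : Prop) [Decidable p] (f : Fin m.n → ℤ),
      (if p then ∑ b, f b else 0) = ∑ b, if p then f b else 0 := by
    intro p _ f
    split_ifs <;> simp
  induction l generalizing x with
  | nil =>
    obtain ⟨a, k⟩ := x
    obtain ⟨c, k'⟩ := y
    simp only [List.map_nil, List.prod_nil, List.sum_nil, add_zero, amplitude, Matrix.one_apply]
    by_cases hac : a = c
    · subst hac
      by_cases hk : k = k'
      · subst hk; simp
      · have h1 : ¬ ((k : ℤ) + off a = k' + off a) := fun h => hk (Fin.ext (by omega))
        simp [hk, h1]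
    · have h1 : (⟨a, k⟩ : m.VirtIndex) ≠ ⟨c, k'⟩ := fun h => hac (congrArg Sigma.fst h)
      simp [hac, h1]
  | cons M l ih =>
    obtain ⟨a, k⟩ := x
    obtain ⟨c, k'⟩ := y
    rw [List.map_cons, List.prod_cons, Matrix.mul_apply, Fintype.sum_sigma, List.map_cons,
      List.sum_cons, amplitude]
    simp only [ih]
    rw [hsum]
    refine Finset.sum_congr rfl fun b _ => ?_
    simp only [intKraus, Matrix.of_apply]
    by_cases hb : 0 ≤ ((k : ℤ) + off a) + M - m.S - off b ∧
        ((k : ℤ) + off a) + M - m.S - off b ≤ m.virt b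
    · rw [Finset.sum_eq_single
        (⟨((k : ℤ) + off a + M - m.S - off b).toNat, by omega⟩ : Fin (m.virt b + 1))]
      · have e : (((k : ℤ) + off a + M - m.S - off b).toNat : ℤ) + off b =
            (k : ℤ) + off a + M - m.S := by omega
        simp only [e, if_true]
        have e2 : (k : ℤ) + off a + M - m.S + (l.map fun M : ℕ => (M : ℤ) - m.S).sum =
            k + off a + (M - m.S + (l.map fun M : ℕ => (M : ℤ) - m.S).sum) := by ring
        rw [e2, mul_ite, mul_zero]
      · intro k'' _ hk''
        rw [if_neg, zero_mul]
        intro h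
        exact hk'' (Fin.ext (by simp only; omega))
      · simp
    · have he : m.entry off w M (k + off a) a b = 0 := by
        rw [entry, if_neg (fun h => hb ⟨h.1, h.2.1⟩)]
      simp [he]

/-- The data relating the Kraus operators to the rescaled ones: the multiplet `a` is rescaled
by `u a`. -/
structure IsGauge (m : Model) (off : Fin m.n → ℕ) (w : Fin m.n → Fin m.n → ℤ) (u : Fin m.n → ℝ)
    (ρ : ℝ) : Prop where
  off_add : ∀ a b, 2 * off a + m.virt a = 2 * off b + m.virt b
  triangle : ∀ a b, w a b ≠ 0 → Triangle (m.virt a) (2 * m.S) (m.virt b)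
  ne_zero : ρ ≠ 0
  scale_ne_zero : ∀ a, u a ≠ 0
  weight : ∀ a b, m.T a b * intNorm (m.virt a) (2 * m.S) (m.virt b) = ρ * (u a * w a b / u b)

/-- The rescaling of the basis vectors. -/
def basisScale (u : Fin m.n → ℝ) (x : m.VirtIndex) : ℝ :=
  u x.1 * rootFact (m.virt x.1) (x.2 : ℕ)

variable {u : Fin m.n → ℝ} {ρ : ℝ}

theorem IsGauge.basisScale_ne_zero (h : m.IsGauge off w u ρ) (x : m.VirtIndex) :
    basisScale u x ≠ 0 :=
  mul_ne_zero (h.scale_ne_zero _) (rootFact_pos _ _).ne'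

/-- Up to a scalar depending on M, a conjugation by a diagonal matrix. The square root of the column
state is written as `intFact` divided by that root, which leaves integers inside. -/
theorem IsGauge.realKraus_apply (h : m.IsGauge off w u ρ) (M : Fin (2 * m.S + 1))
    (x y : m.VirtIndex) : m.realKraus M x y = ρ * rootFact (2 * m.S) (M : ℕ) *
      (basisScale u x * (m.intKraus off w M x y : ℝ) / basisScale u y) := by
  obtain ⟨a, k⟩ := x
  obtain ⟨b, l⟩ := y
  have hT := h.weight a b
  have hoff := h.off_add a b
  simp only [realKraus, intKraus, Matrix.of_apply, cg_eq_cgInt, basisScale]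
  by_cases hw : w a b = 0
  · have hT0 : m.T a b = 0 := by
      rw [hw, Int.cast_zero, mul_zero, zero_div, mul_zero] at hT
      exact (mul_eq_zero.mp hT).resolve_right (intNorm_pos _ _ _).ne'
    have he : m.entry off w M (k + off a) a b = 0 := by simp [entry, hw]
    rw [hT0, he]
    simp
  · have ht := h.triangle a b hw
    obtain ⟨t1, t2, t3, r, hr⟩ := ht
    by_cases hk : (k : ℤ) + off a + (M : ℕ) - m.S = l + off b
    · have hl := l.is_le
      rw [if_pos hk, entry, if_pos ⟨by omega, by omega, hw⟩,
        cgInt_eq_intRacah (h.triangle a b hw) (by omega),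
        show (k : ℤ) + off a + (M : ℕ) - m.S - off b = l by omega,
        show (k : ℤ) + off a - off a = k by ring]
      push_cast
      rw [← rootFact_mul_self]
      have h1 := (rootFact_pos (m.virt b) l).ne'
      have h2 := h.scale_ne_zero b
      field_simp at hT ⊢
      linear_combination rootFact (m.virt a) (k : ℕ) * rootFact (2 * m.S) (M : ℕ) *
        (intRacah (m.virt a) (2 * m.S) (m.virt b) (k : ℕ) (M : ℕ) : ℝ) * hT
    · rw [if_neg hk, cgInt, if_neg (fun hh => hk (by have := hh.2; omega))]
      simp

theorem IsGauge.prod_realKraus_apply (h : m.IsGauge off w u ρ) (l : List (Fin (2 * m.S + 1)))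
    (x y : m.VirtIndex) : (l.map m.realKraus).prod x y =
      (l.map fun M : Fin (2 * m.S + 1) => ρ * rootFact (2 * m.S) (M : ℕ)).prod *
        (basisScale u x * (((l.map fun M : Fin (2 * m.S + 1) => (M : ℕ)).map (m.intKraus off w)).prod x y : ℤ) /
          basisScale u y) := by
  induction l generalizing x with
  | nil =>
    by_cases hxy : x = y
    · subst hxy
      simp [h.basisScale_ne_zero x]
    · simp [hxy]
  | cons M l ih =>
    simp only [List.map_cons, List.prod_cons, Matrix.mul_apply, ih, h.realKraus_apply M]
    push_cast
    rw [Finset.mul_sum, Finset.sum_div, Finset.mul_sum]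
    refine Finset.sum_congr rfl fun z _ => ?_
    have := h.basisScale_ne_zero z
    field_simp

/-- The diagonal conjugation drops out of the trace; a word of total weight zero is needed for
diagonal entries to survive. -/
theorem IsGauge.trace_prod_realKraus_ne_zero (h : m.IsGauge off w u ρ)
    (l : List (Fin (2 * m.S + 1))) (hl : (l.map fun M : Fin (2 * m.S + 1) => ((M : ℕ) : ℤ) - m.S).sum = 0)
    (ht : m.intTrace off w (l.map fun M : Fin (2 * m.S + 1) => (M : ℕ)) ≠ 0) : (l.map m.realKraus).prod.trace ≠ 0 := by
  have h1 : (l.map m.realKraus).prod.trace =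
      (l.map fun M : Fin (2 * m.S + 1) => ρ * rootFact (2 * m.S) (M : ℕ)).prod *
        (m.intTrace off w (l.map fun M : Fin (2 * m.S + 1) => (M : ℕ)) : ℝ) := by
    rw [Matrix.trace, Fintype.sum_sigma, intTrace]
    push_cast
    rw [Finset.mul_sum]
    refine Finset.sum_congr rfl fun a _ => ?_
    rw [Finset.mul_sum]
    refine Finset.sum_congr rfl fun k _ => ?_
    rw [Matrix.diag_apply, h.prod_realKraus_apply, prod_intKraus_apply, List.map_map]
    have := h.basisScale_ne_zero ⟨a, k⟩
    rw [if_pos (by simpa [Function.comp_def] using hl)]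
    field_simp
  rw [h1]
  refine mul_ne_zero (List.prod_ne_zero fun h0 => ?_) (by exact_mod_cast ht)
  obtain ⟨M, -, hM⟩ := List.mem_map.mp h0
  exact mul_ne_zero h.ne_zero (rootFact_pos _ _).ne' hM

/-- Weight conservation leaves one admissible k for each pair of lowest states. The roots of the
physical states occur twice, from the Kraus operator and from the coupling coefficient, hence as
integers. -/
theorem IsGauge.couple_apply (h : m.IsGauge off w u ρ) {s : ℕ} (hs : s ≤ 2 * m.S)
    (k : Fin (2 * s + 1)) (a c : Fin m.n) :
    couple (2 * s) m.realKraus k ⟨a, 0⟩ ⟨c, 0⟩ =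
      if (k : ℤ) + off a = s + off c then
        intNorm (2 * m.S) (2 * m.S) (2 * s) * rootFact (2 * s) (k : ℕ) * (ρ * ρ) *
          (basisScale u ⟨a, 0⟩ / basisScale u ⟨c, 0⟩) * m.intCouple off w s a c
      else 0 := by
  have hprod : ∀ i j, (m.realKraus i * m.realKraus j) ⟨a, 0⟩ ⟨c, 0⟩ =
      (ρ * rootFact (2 * m.S) (i : ℕ)) * (ρ * rootFact (2 * m.S) (j : ℕ)) *
        (basisScale u ⟨a, 0⟩ * ((if off a + i + j = off c + 2 * m.S then
          m.amplitude off w [i, j] (off a) a c else 0 : ℤ) : ℝ) / basisScale u ⟨c, 0⟩) := by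
    intro i j
    have h1 := h.prod_realKraus_apply [i, j] ⟨a, 0⟩ ⟨c, 0⟩
    rw [prod_intKraus_apply] at h1
    simp only [List.map_cons, List.map_nil, List.prod_cons, List.prod_nil, mul_one, List.sum_cons,
      List.sum_nil, add_zero, Fin.val_zero, Nat.cast_zero, zero_add] at h1
    rw [h1]
    have hiff : ((off a : ℤ) + ((i : ℕ) - m.S + ((j : ℕ) - m.S)) = off c) ↔
        off a + i + j = off c + 2 * m.S := by omega
    simp only [hiff]
  have htri : Triangle (2 * m.S) (2 * m.S) (2 * s) :=
    ⟨by omega, by omega, by omega, ⟨2 * m.S + s, by ring⟩⟩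
  unfold couple intCouple
  simp only [Matrix.sum_apply, Matrix.smul_apply, smul_eq_mul, hprod, cg_eq_cgInt]
  have ha : (2 * m.S + 2 * m.S - 2 * s) / 2 = 2 * m.S - s := by omega
  split_ifs with hk
  · push_cast
    rw [Finset.mul_sum]
    refine Finset.sum_congr rfl fun i _ => ?_
    rw [Finset.mul_sum]
    refine Finset.sum_congr rfl fun j _ => ?_
    split_ifs with hij
    · rw [cgInt_eq_intRacah htri (by rw [ha]; omega)]
      rw [← rootFact_mul_self, ← rootFact_mul_self]
      ring
    · simp
  · refine Finset.sum_eq_zero fun i _ => Finset.sum_eq_zero fun j _ => ?_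
    split_ifs with hij
    · rw [cgInt, if_neg (fun hh => hk (by have := hh.2; rw [ha] at this; omega)), zero_mul]
    · simp

theorem IsGauge.couple_eq_zero (h : m.IsGauge off w u ρ) {s : ℕ} (hs : s ≤ 2 * m.S)
    (h0 : ∀ a c, m.intCouple off w s a c = 0) (k : Fin (2 * s + 1)) :
    couple (2 * s) m.realKraus k = 0 := by
  refine (isTensorOp_realKraus.couple (2 * s)).eq_zero (fun k a c => ?_) k
  rw [h.couple_apply hs, h0]
  simp

theorem IsGauge.couple_zero (h : m.IsGauge off w u ρ) {t : ℤ}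
    (h0 : ∀ a c, m.intCouple off w 0 a c = if a = c then t else 0) :
    couple 0 m.realKraus 0 = (intNorm (2 * m.S) (2 * m.S) 0 * (ρ * ρ) * t : ℝ) • 1 := by
  refine (isTensorOp_realKraus.couple 0).eq_smul_one _ fun a c => ?_
  have h1 := h.couple_apply (s := 0) (by omega) 0 a c
  rw [mul_zero] at h1
  rw [h1, h0]
  by_cases hac : a = c
  · subst hac
    have := h.basisScale_ne_zero ⟨a, 0⟩
    simp only [if_true, Nat.cast_zero, Fin.val_zero]
    rw [div_self this]
    simp [rootFact]
  · simp [hac]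

theorem IsGauge.fusionRule (h : m.IsGauge off w u ρ) : m.FusionRule := by
  intro a b hab
  by_contra hT
  have hw : w a b ≠ 0 := by
    intro hw
    have := h.weight a b
    rw [hw, Int.cast_zero, mul_zero, zero_div, mul_zero] at this
    exact mul_ne_zero hT (intNorm_pos _ _ _).ne' this
  obtain ⟨t1, t2, t3, -⟩ := h.triangle a b hw
  refine hab ⟨?_, by omega⟩
  rw [abs_le]
  omega

theorem IsGauge.triangle_of_weight_ne_zero (h : m.IsGauge off w u ρ) (a b : Fin m.n)
    (hT : m.T a b ≠ 0) : Triangle (m.virt a) (2 * m.S) (m.virt b) := by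
  refine h.triangle a b fun hw => ?_
  have := h.weight a b
  rw [hw, Int.cast_zero, mul_zero, zero_div, mul_zero] at this
  exact mul_ne_zero hT (intNorm_pos _ _ _).ne' this

end

/-- The properties of the matrix product state of a model. -/
def HasGroundState (m : Model) : Prop :=
  m.FusionRule ∧ m.WeightIsometry ∧ m.KrausIsometry ∧ m.RenormalizationCondition ∧
    ∀ (J : ℕ → ℝ), (∀ ST ∈ m.K, 0 < J ST) → ∀ N : ℕ, 2 ≤ N →
      (m.hamiltonian J N).IsPositive ∧ m.hamiltonian J N (m.mps N) = 0 ∧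
        (Even N ∨ 2 * m.S + 1 ≤ N → m.mps N ≠ 0)

/-- The site configuration `0, 1, -1, 2, -2, …, S, -S`. -/
def alternatingWord (S : ℕ) : List (Fin (2 * S + 1)) :=
  ⟨S, by omega⟩ :: (List.finRange S).flatMap fun k : Fin S =>
    [⟨S + k + 1, by have := k.is_lt; omega⟩, ⟨S - k - 1, by omega⟩]

theorem length_alternatingWord (S : ℕ) : (alternatingWord S).length = 2 * S + 1 := by
  simp [alternatingWord, List.length_flatMap, mul_comm]

theorem sum_alternatingWord (S : ℕ) :
    ((alternatingWord S).map fun M : Fin (2 * S + 1) => ((M : ℕ) : ℤ) - S).sum = 0 := by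
  rw [alternatingWord, List.map_cons, List.sum_cons, List.map_flatMap, sub_self, zero_add]
  induction List.finRange S with
  | nil => rfl
  | cons k l ih =>
    rw [List.flatMap_cons, List.sum_append, ih]
    have := k.is_lt
    simp only [List.map_cons, List.map_nil, List.sum_cons, List.sum_nil]
    omega

/-- The integer identities behind the renormalization condition and the nonvanishing of the matrix
product state. -/
def IntegralConditions (m : Model) (off : Fin m.n → ℕ) (w : Fin m.n → Fin m.n → ℤ)
    (a₀ : Fin m.n) : Prop :=
  (∀ s ∈ m.K, s ≤ 2 * m.S ∧ ∀ a c, m.intCouple off w s a c = 0) ∧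
    m.intCouple off w 0 a₀ a₀ ≠ 0 ∧
    (∀ a c, m.intCouple off w 0 a c = if a = c then m.intCouple off w 0 a₀ a₀ else 0) ∧
    m.intTrace off w ((alternatingWord m.S).map fun M : Fin (2 * m.S + 1) => (M : ℕ)) ≠ 0

instance (m : Model) (off : Fin m.n → ℕ) (w : Fin m.n → Fin m.n → ℤ) (a₀ : Fin m.n) :
    Decidable (m.IntegralConditions off w a₀) :=
  inferInstanceAs (Decidable (_ ∧ _ ∧ _ ∧ _))

theorem IsGauge.hasGroundState {m : Model} {off : Fin m.n → ℕ} {w : Fin m.n → Fin m.n → ℤ}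
    {u : Fin m.n → ℝ} {ρ : ℝ} (h : m.IsGauge off w u ρ) (hinj : Function.Injective m.virt)
    (hnorm : ∀ b, ∑ a, m.T a b ^ 2 = 1)
    {a₀ : Fin m.n} (hint : decide (m.IntegralConditions off w a₀) = true) :
    m.HasGroundState := by
  obtain ⟨hK, h₀, h₀', htr⟩ := of_decide_eq_true hint
  have hcouple : ∀ s ∈ m.K, ∀ k, couple (2 * s) m.realKraus k = 0 := fun s hs =>
    h.couple_eq_zero (hK s hs).1 (hK s hs).2
  refine ⟨h.fusionRule, weightIsometry_of_norm hinj hnorm,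
    krausIsometry_of_norm hinj h.triangle_of_weight_ne_zero hnorm,
    renormalizationCondition_of_couple hcouple, fun J hJ N hN =>
    ⟨hamiltonian_isPositive hJ N, hamiltonian_mps hcouple J hN, fun hN' => ?_⟩⟩
  have ht : intNorm (2 * m.S) (2 * m.S) 0 * (ρ * ρ) * (m.intCouple off w 0 a₀ a₀ : ℝ) ≠ 0 :=
    mul_ne_zero (mul_ne_zero (intNorm_pos _ _ _).ne' (mul_ne_zero h.ne_zero h.ne_zero))
      (by exact_mod_cast h₀)
  rcases Nat.even_or_odd' N with ⟨n, hn | hn⟩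
  -- Even N: the empty word, whose trace is the dimension of the virtual space.
  · refine mps_ne_zero ht (h.couple_zero h₀') [] ?_ (n := n) (by simp; omega)
    have : Nonempty m.VirtIndex := ⟨⟨a₀, 0⟩⟩
    rw [List.map_nil, List.prod_nil, Matrix.trace_one]
    exact_mod_cast Fintype.card_ne_zero
  · have hge : 2 * m.S + 1 ≤ N := hN'.resolve_left (by rw [Nat.not_even_iff_odd]; exact ⟨n, hn⟩)
    -- Odd N = 2n + 1: the alternating word uses 2S + 1 sites and n - S singlet pairs fill the rest.
    exact mps_ne_zero ht (h.couple_zero h₀') _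
      (h.trace_prod_realKraus_ne_zero _ (sum_alternatingWord m.S) htr) (n := n - m.S)
      (by rw [length_alternatingWord]; omega)

end Model

end SpinChain

/-! ### The ten models. -/

namespace SpinChain.Model

theorem hasGroundState_irreducible (S : ℕ) (K : Finset ℕ) (J : ℕ) (hJ : Triangle J (2 * S) J)
    (hint : ∀ a, decide ((irreducible S K J).IntegralConditions (fun _ => 0) (fun _ _ => 1) a) =
      true) : (irreducible S K J).HasGroundState := by
  have hv : ∀ a, (irreducible S K J).virt a = J := fun a => by
    rw [show a = (0 : Fin 1) from Subsingleton.elim (α := Fin 1) _ _]; rfl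
  have hT : ∀ a b, (irreducible S K J).T a b = 1 := fun a b => by
    rw [show a = (0 : Fin 1) from Subsingleton.elim (α := Fin 1) _ _,
      show b = (0 : Fin 1) from Subsingleton.elim (α := Fin 1) _ _]
    simp [irreducible]
  have hg : (irreducible S K J).IsGauge (fun _ => 0) (fun _ _ => 1) (fun _ => 1)
      (intNorm J (2 * S) J) := by
    refine ⟨fun a b => ?_, fun a b _ => ?_, (intNorm_pos _ _ _).ne', fun _ => one_ne_zero,
      fun a b => ?_⟩
    · rw [hv, hv]
    · rw [hv, hv]; exact hJ
    · rw [hv, hv, hT]; simp [irreducible]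
  refine hg.hasGroundState (fun a b _ => Subsingleton.elim (α := Fin 1) a b) (fun b => ?_)
    (hint (0 : Fin 1))
  simp only [hT, one_pow]
  exact Fin.sum_univ_one (fun _ => (1 : ℝ))

/-- An identity between square roots is checked by squaring, once t and w are known not to have
opposite signs. It serves the `weight` field of `IsGauge`, with √q the normalization, √κ = ρ and √x,
√y the scales of row and column. -/
theorem mul_sqrt_eq {t q κ x y w : ℝ} (hq : 0 ≤ q) (hκ : 0 ≤ κ) (hx : 0 ≤ x) (hy : 0 < y)
    (hs : 0 ≤ t * w) (h : t ^ 2 * q * y = κ * x * w ^ 2) : t * √q = √κ * (√x * w / √y) := by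
  have hy' : √y ≠ 0 := (Real.sqrt_pos.mpr hy).ne'
  rw [← mul_div_assoc, eq_div_iff hy']
  have h2 : (t * √q * √y) ^ 2 = (√κ * (√x * w)) ^ 2 := by
    simp only [mul_pow, Real.sq_sqrt hq, Real.sq_sqrt hκ, Real.sq_sqrt hx, Real.sq_sqrt hy.le]
    linarith
  rcases sq_eq_sq_iff_eq_or_eq_neg.mp h2 with h3 | h3
  · exact h3
  · have h4 : (t * √q * √y) * (√κ * (√x * w)) = (t * w) * (√q * √y * √κ * √x) := by ring
    have h5 : 0 ≤ (t * √q * √y) * (√κ * (√x * w)) := by rw [h4]; positivity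
    rw [h3] at h5 ⊢
    have h6 : √κ * (√x * w) = 0 := by nlinarith [sq_nonneg (√κ * (√x * w))]
    rw [h6, neg_zero]

theorem forall_fin_three {p : Fin 3 → Prop} : (∀ a, p a) ↔ p 0 ∧ p 1 ∧ p 2 := by
  simp [Fin.forall_fin_succ]

/-- The rescaled weight matrix of `so7`. -/
def so7Weight : Fin 2 → Fin 2 → ℤ :=
  ![![0, -6], ![6, 1]]

/-- The offsets align the weights with those of the largest virtual spin. The constant ρ is the
product of `T` and `intNorm` at the last diagonal entry, which makes the last integer weight 1; the
same choice is made for `so9` and `so11`. -/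
theorem isGauge_so7 : so7.IsGauge ![3, 0] so7Weight
    (fun a => √((![1, 1] : Fin 2 → ℝ) a)) √(1 / 130636800) where
  off_add := by decide
  triangle := by
    change ∀ a b : Fin 2, so7Weight a b ≠ 0 →
      Triangle ((![0, 6] : Fin 2 → ℕ) a) 6 ((![0, 6] : Fin 2 → ℕ) b)
    decide
  ne_zero := by positivity
  scale_ne_zero := by
    refine Fin.forall_fin_two.mpr ⟨?_, ?_⟩ <;> simp
  weight := by
    refine Fin.forall_fin_two.mpr ⟨Fin.forall_fin_two.mpr ⟨?_, ?_⟩, Fin.forall_fin_two.mpr ⟨?_, ?_⟩⟩ <;>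
      refine mul_sqrt_eq (by positivity) (by norm_num) (by simp) (by simp) ?_ ?_
    all_goals first
      | (refine mul_nonneg ?_ ?_ <;> simp [so7, so7Weight] <;> positivity)
      | (refine mul_nonneg_of_nonpos_of_nonpos ?_ ?_ <;>
          simp [so7, so7Weight, neg_div])
      | (simp [so7, so7Weight, Nat.factorial, div_pow, -one_div] <;> norm_num)

theorem hasGroundState_so7 : so7.HasGroundState := by
  refine isGauge_so7.hasGroundState ?_ ?_ (a₀ := (0 : Fin 2)) ?_
  · change Function.Injective (![0, 6] : Fin 2 → ℕ)
    decide
  · refine Fin.forall_fin_two.mpr ⟨?_, ?_⟩ <;>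
      refine (Fin.sum_univ_two _).trans ?_ <;> simp [so7, div_pow] <;> norm_num
  · decide +kernel

/-- The rescaled weight matrix of `so9`. -/
def so9Weight : Fin 2 → Fin 2 → ℤ :=
  ![![25200, 120], ![-120, 1]]

theorem isGauge_so9 : so9.IsGauge ![3, 0] so9Weight
    (fun a => √((![1, 1] : Fin 2 → ℝ) a)) √(1 / 68263894056960000) where
  off_add := by decide
  triangle := by
    change ∀ a b : Fin 2, so9Weight a b ≠ 0 →
      Triangle ((![4, 10] : Fin 2 → ℕ) a) 8 ((![4, 10] : Fin 2 → ℕ) b)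
    decide
  ne_zero := by positivity
  scale_ne_zero := by
    refine Fin.forall_fin_two.mpr ⟨?_, ?_⟩ <;> simp
  weight := by
    refine Fin.forall_fin_two.mpr ⟨Fin.forall_fin_two.mpr ⟨?_, ?_⟩, Fin.forall_fin_two.mpr ⟨?_, ?_⟩⟩ <;>
      refine mul_sqrt_eq (by positivity) (by norm_num) (by simp) (by simp) ?_ ?_
    all_goals first
      | (refine mul_nonneg ?_ ?_ <;> simp [so9, so9Weight] <;> positivity)
      | (refine mul_nonneg_of_nonpos_of_nonpos ?_ ?_ <;>
          simp [so9, so9Weight, neg_div, neg_mul] <;> positivity)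
      | (simp [so9, so9Weight, Nat.factorial, div_pow, mul_pow, -one_div] <;> norm_num)

theorem hasGroundState_so9 : so9.HasGroundState := by
  refine isGauge_so9.hasGroundState ?_ ?_ (a₀ := (0 : Fin 2)) ?_
  · change Function.Injective (![4, 10] : Fin 2 → ℕ)
    decide
  · refine Fin.forall_fin_two.mpr ⟨?_, ?_⟩ <;>
      refine (Fin.sum_univ_two _).trans ?_ <;> (simp [so9, div_pow, mul_pow]; norm_num)
  · decide +kernel

/-- The rescaled weight matrix of `so11`. -/
def so11Weight : Fin 3 → Fin 3 → ℤ :=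
  ![![495331200, -49896000, -1260], ![-58968000, 831600, -150], ![32760, 3300, 1]]

theorem isGauge_so11 : so11.IsGauge ![5, 3, 0] so11Weight
    -- The square roots 26 and 22 absorb the irrational ratios of the entries, so that the rescaled
    -- weights are integers.
    (fun a => √((![26, 22, 1] : Fin 3 → ℝ) a)) √(1 / 270865940831513188761600000000) where
  off_add := by decide
  triangle := by
    change ∀ a b : Fin 3, so11Weight a b ≠ 0 →
      Triangle ((![5, 9, 15] : Fin 3 → ℕ) a) 10 ((![5, 9, 15] : Fin 3 → ℕ) b)
    decide
  ne_zero := by positivity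
  scale_ne_zero := by
    refine forall_fin_three.mpr ⟨?_, ?_, ?_⟩ <;> simp
  weight := by
    refine forall_fin_three.mpr ⟨forall_fin_three.mpr ⟨?_, ?_, ?_⟩,
      forall_fin_three.mpr ⟨?_, ?_, ?_⟩, forall_fin_three.mpr ⟨?_, ?_, ?_⟩⟩ <;>
      refine mul_sqrt_eq (by positivity) (by norm_num) (by simp) (by simp) ?_ ?_
    all_goals first
      | (refine mul_nonneg ?_ ?_ <;> simp [so11, so11Weight] <;> positivity)
      | (refine mul_nonneg_of_nonpos_of_nonpos ?_ ?_ <;>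
          simp [so11, so11Weight, neg_div, neg_mul] <;> positivity)
      | (simp [so11, so11Weight, Nat.factorial, div_pow, mul_pow, -one_div] <;> norm_num)

theorem hasGroundState_so11 : so11.HasGroundState := by
  refine isGauge_so11.hasGroundState ?_ ?_ (a₀ := (0 : Fin 3)) ?_
  · change Function.Injective (![5, 9, 15] : Fin 3 → ℕ)
    decide
  · refine forall_fin_three.mpr ⟨?_, ?_, ?_⟩ <;>
      refine (Fin.sum_univ_three _).trans ?_ <;> (simp [so11, div_pow, mul_pow]; norm_num)
  · decide +kernel

end SpinChain.Model

theorem mainTheorem2 (m : SpinChain.Model) (hm : m ∈ SpinChain.Model.table) :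
    m.FusionRule ∧ m.WeightIsometry ∧ m.KrausIsometry ∧ m.RenormalizationCondition ∧
      ∀ (J : ℕ → ℝ), (∀ ST ∈ m.K, 0 < J ST) → ∀ N : ℕ, 2 ≤ N →
        (m.hamiltonian J N).IsPositive ∧ m.hamiltonian J N (m.mps N) = 0 ∧
          (Even N ∨ 2 * m.S + 1 ≤ N → m.mps N ≠ 0) := by
  change m.HasGroundState
  simp only [SpinChain.Model.table, List.mem_cons, List.not_mem_nil, or_false] at hm
  rcases hm with rfl | rfl | rfl | rfl | rfl | rfl | rfl | rfl | rfl | rfl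
  case inr.inr.inr.inr.inl => exact SpinChain.Model.hasGroundState_so7
  case inr.inr.inr.inr.inr.inr.inl => exact SpinChain.Model.hasGroundState_so9
  case inr.inr.inr.inr.inr.inr.inr.inr.inl => exact SpinChain.Model.hasGroundState_so11
  all_goals
    exact SpinChain.Model.hasGroundState_irreducible _ _ _ (by decide)
      (Fin.forall_fin_one.mpr (by decide +kernel))
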